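/- A weight function is a continuous increasing (i.e. non-decreasing) function $\omega:[0,\infty)\to[0,\infty)$ such that: ($\alpha$) there is $K\ge 1$ with $\omega(2x)\le K(1+\omega(x))$ for all $x\ge0$; ($\beta$) $\omega(x)=o(x)$ as $x\to\infty$; ($\gamma$) there are $a\in\mathbb{R}$, $b>0$ with $\omega(x)\ge a+b\log(1+x)$ for all $x\ge 0$; ($\delta$) $t\mapsto\omega(e^t)$ is convex on $\mathbb{R}$. Its Young conjugate is $\varphi^*_\omega(s)=\sup_{t\ge0}\{ts-\omega(e^t)\}\in(-\infty,\infty]$, $s\ge0$. Let $\omega_1,\dots,\omega_N,\sigma_1,\dots,\sigma_N$ be weight functions and put, for $x\in\mathbb{R}^N$ and $y\in[0,\infty)^N$, $$\Omega(x)=\sum_{j=1}^N\omega_j(|x_j|),\quad \Sigma(x)=\sum_{j=1}^N\sigma_j(|x_j|),\quad \Omega^*(y)=\sum_{j=1}^N\varphi^*_{\omega_j}(y_j),\quad \Sigma^*(y)=\sum_{j=1}^N\varphi^*_{\sigma_j}(y_j).$$ Write $\hat f(\xi)=\int_{\mathbb{R}^N}e^{-ix\cdot\xi}f(x)\,dx$,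 $D^\alpha=(-i)^{|\alpha|}\partial^\alpha$, and $\exp(-\infty)=0$. Let $\mathcal{S}^\Sigma_\Omega(\mathbb{R}^N)$ be the set of all $f\in L^1(\mathbb{R}^N)$ such that $f,\hat f\in C^\infty(\mathbb{R}^N)$ and, for all $\lambda>0$ and $\alpha\in\mathbb{N}_0^N$, $\|\exp(\lambda\Omega)D^\alpha f\|_\infty<\infty$ and $\|\exp(\lambda\Sigma)D^\alpha\hat f\|_\infty<\infty$. **Theorem.** Let $f\in\mathcal{S}(\mathbb{R}^N)$ and $1\le p,q\le\infty$. The following conditions are equivalent. 1. $f\in\mathcal{S}^\Sigma_\Omega(\mathbb{R}^N)$. 2. $\|\exp(\lambda\Omega)D^\alpha f\|_p<\infty$ and $\|\exp(\lambda\Sigma)D^\alpha\hat f\|_q<\infty$ for all $\lambda>0$ and $\alpha\in\mathbb{N}_0^N$. 3. $\|\exp(\lambda\Omega) f\|_p<\infty$ and $\|\exp(\lambda\Sigma)\hat f\|_q<\infty$ for all $\lambda>0$. 4. $\|\exp(\lambda\Omega)x^\alpha f\|_p<\infty$ and $\|\exp(\lambda\Sigma)\xi^\alpha\hat f\|_q<\infty$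 for all $\lambda>0$ and $\alpha\in\mathbb{N}_0^N$. 5. Both of the following hold: (a) for each $\lambda>0$ and $\beta\in\mathbb{N}_0^N$ there is $C_{\beta,\lambda}>0$ such that for every $\alpha\in\mathbb{N}_0^N$ $$\left\|\exp\left(-\lambda\Sigma^*\left(\tfrac{\alpha}{\lambda}\right)\right)x^\beta D^\alpha f\right\|_p\le C_{\beta,\lambda};$$ (b) for each $\mu>0$ and $\alpha\in\mathbb{N}_0^N$ there is $C_{\alpha,\mu}>0$ such that for every $\beta\in\mathbb{N}_0^N$ $$\left\|\exp\left(-\mu\Omega^*\left(\tfrac{\beta}{\mu}\right)\right)x^\beta D^\alpha f\right\|_q\le C_{\alpha,\mu}.$$ 6. For each $\lambda,\mu>0$ there is $C_{\mu,\lambda}>0$ such that for all $\alpha,\beta\in\mathbb{N}_0^N$ $$\left\|\exp\left(-\lambda\Sigma^*\left(\tfrac{\alpha}{\lambda}\right)-\mu\Omega^*\left(\tfrac{\beta}{\mu}\right)\right)x^\beta D^\alpha f\right\|_p\le C_{\mu,\lambda}.$$ -/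

import Mathlib

open MeasureTheory Filter
open scoped ENNReal SchwartzMap

noncomputable section

/-- `ω`, restricted to `[0, ∞)`, is a weight function. Only the values of `ω` on `[0, ∞)` are ever
used; the extension to the whole line is `x ↦ ω |x|`. -/
structure IsWeightFunction (ω : ℝ → ℝ) : Prop where
  continuousOn : ContinuousOn ω (Set.Ici 0)
  monotoneOn : MonotoneOn ω (Set.Ici 0)
  nonneg : ∀ x : ℝ, 0 ≤ x → 0 ≤ ω x
  doubling : ∃ K : ℝ, 1 ≤ K ∧ ∀ x : ℝ, 0 ≤ x → ω (2 * x) ≤ K * (1 + ω x)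
  isLittleO_id : ω =o[atTop] (fun x : ℝ => x)
  log_le : ∃ a b : ℝ, 0 < b ∧ ∀ x : ℝ, 0 ≤ x → a + b * Real.log (1 + x) ≤ ω x
  convex_comp_exp : ConvexOn ℝ Set.univ (fun t : ℝ => ω (Real.exp t))

/-- The weight `ω₁ ⊕ ⋯ ⊕ ω_N` on `ℝ^N`, `x ↦ ω₁(|x₁|) + ⋯ + ω_N(|x_N|)`. -/
def sumWeight {N : ℕ} (ω : Fin N → ℝ → ℝ) (x : EuclideanSpace ℝ (Fin N)) : ℝ :=
  ∑ j, ω j |x j|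

/-- The Young conjugate `φ*(s) = sup_{t ≥ 0} (t s - ω(e^t))`, with values in `(-∞, ∞]`: the value
`∞` does occur, for instance for `ω(x) = log (1 + x)` and `s > 1`. -/
def youngConj (ω : ℝ → ℝ) (s : ℝ) : EReal :=
  ⨆ t ∈ Set.Ici (0 : ℝ), ((t * s - ω (Real.exp t) : ℝ) : EReal)

/-- `y ↦ φ*_{ω₁}(y₁) + ⋯ + φ*_{ω_N}(y_N)`, for `y` with nonnegative entries. -/
def sumYoungConj {N : ℕ} (ω : Fin N → ℝ → ℝ) (y : Fin N → ℝ) : EReal :=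
  ∑ j, youngConj (ω j) (y j)

/-- The exponential on `[-∞, ∞)`, with `exp (-∞) = 0` (it is never used at `+∞`). -/
def expE (a : EReal) : ℝ := (EReal.exp a).toReal

/-- The monomial `x^β`. -/
def monomialFun {N : ℕ} (β : Fin N → ℕ) (x : EuclideanSpace ℝ (Fin N)) : ℝ :=
  ∏ j, x j ^ β j

/-- `D^α f = (-i)^{|α|} ∂^α f`: the derivative of order `|α|` is evaluated at the tuple that
contains the `j`-th standard basis vector exactly `α j` times, for each `j`. -/
def multiDeriv {N : ℕ} (α : Fin N → ℕ) (f : EuclideanSpace ℝ (Fin N) → ℂ)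
    (x : EuclideanSpace ℝ (Fin N)) : ℂ :=
  (-Complex.I) ^ (∑ j, α j) *
    iteratedFDeriv ℝ (∑ j, α j) f x
      (fun i => EuclideanSpace.single (finSigmaFinEquiv.symm i).1 (1 : ℝ))

/-- The Fourier transform `∫ e^{-i x·ξ} f(x) dx`. -/
def fourierHat {N : ℕ} (f : EuclideanSpace ℝ (Fin N) → ℂ) (ξ : EuclideanSpace ℝ (Fin N)) : ℂ :=
  ∫ x, Complex.exp (-Complex.I * (inner ℝ x ξ : ℝ)) * f x

/-- The space `S^Σ_Ω(ℝ^N)` with `Ω = ω₁ ⊕ ⋯ ⊕ ω_N` and `Σ = σ₁ ⊕ ⋯ ⊕ σ_N`. -/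
def ultraSpace {N : ℕ} (ω σ : Fin N → ℝ → ℝ) : Set (EuclideanSpace ℝ (Fin N) → ℂ) :=
  {f | Integrable f volume ∧ ContDiff ℝ ((⊤ : ℕ∞) : WithTop ℕ∞) f ∧ ContDiff ℝ ((⊤ : ℕ∞) : WithTop ℕ∞) (fourierHat f) ∧
    (∀ r : ℝ, 0 < r → ∀ α : Fin N → ℕ,
      eLpNorm (fun x => (Real.exp (r * sumWeight ω x) : ℂ) * multiDeriv α f x) ∞ volume < ∞) ∧
    (∀ r : ℝ, 0 < r → ∀ α : Fin N → ℕ,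
      eLpNorm (fun ξ => (Real.exp (r * sumWeight σ ξ) : ℂ) * multiDeriv α (fourierHat f) ξ)
        ∞ volume < ∞)}

end


/-!
Rapid decay of `f` with respect to `Ω` and of its Fourier transform with respect to `Σ` already
imply all the other conditions. The windowed transform `V(x, ξ) = 𝓕 (exp (-π ‖x - ·‖²) f) (ξ)` is
bounded both by the convolution of `|f|` with a Gaussian at `x` and by that of `|𝓕 f|` with a
Gaussian at `ξ`; the geometric mean of the two bounds gives decay like `exp (-r Ω x - s Σ ξ)`, since
the weights are subadditive up to constants. Dividing the Fourier inversion formula of the window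
by the Gaussian yields

  `f y = ∬ V(x, ξ) exp (-π ‖s‖² - 2π ⟨x, s⟩) exp (2πi ⟨ξ, y⟩ + 2π ⟨s, y⟩) dξ ds`

for every centre `x`. Differentiating in `y` under the integral sign and then putting `y = x`, one
gets derivatives of `f` that keep the decay of `f`. Their growth in the order `α` is that of the
powers of `ξ` and `s`, which the factor `exp (-λ Σ* (α / λ))` turns into at most `exp (λ Σ)`.

Conversely `exp (λ Σ ξ)` is bounded by a sum over `α` of the monomials `|ξ ^ α|` times these
factors: a suitable `α` is read off a subgradient of the convex functions `t ↦ σ_j (e ^ t)` at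
`log |ξ_j|`. Thus the conditions involving Young conjugates give back rapid decay, and Hölder's
inequality exchanges the exponents `p` and `q`, because all powers of `1 + ‖x‖` are dominated by
`exp (c Ω x)`.
-/

lemma exists_nonneg_subgradient_of_monotone {φ : ℝ → ℝ} (hconv : ConvexOn ℝ Set.univ φ)
    (hmono : Monotone φ) (t₀ : ℝ) : ∃ s : ℝ, 0 ≤ s ∧ ∀ t, φ t₀ + s * (t - t₀) ≤ φ t := by
  have hi : t₀ ∈ interior (Set.univ : Set ℝ) := by simp
  have supporting : ∀ t, φ t₀ + derivWithin φ (Set.Ioi t₀) t₀ * (t - t₀) ≤ φ t := by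
    intro t
    rcases lt_trichotomy t t₀ with ht | rfl | ht
    · have h := (hconv.slope_le_leftDeriv_of_mem_interior (Set.mem_univ t) hi ht).trans
        (hconv.leftDeriv_le_rightDeriv_of_mem_interior hi)
      rw [slope_def_field, div_le_iff₀ (by linarith)] at h
      linarith
    · simp
    · have h := hconv.rightDeriv_le_slope_of_mem_interior hi (Set.mem_univ t) ht
      rw [slope_def_field, le_div_iff₀ (by linarith)] at h
      linarith
  refine ⟨_, ?_, supporting⟩
  have h := (supporting (t₀ - 1)).trans (hmono (sub_le_self t₀ zero_le_one))
  linarith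

lemma expE_nonneg (a : EReal) : 0 ≤ expE a := ENNReal.toReal_nonneg

lemma expE_coe (a : ℝ) : expE a = Real.exp a := by
  simp [expE, EReal.exp_coe, ENNReal.toReal_ofReal (Real.exp_pos a).le]

lemma expE_add (a b : EReal) : expE (a + b) = expE a * expE b := by
  simp [expE, EReal.exp_add]

lemma expE_neg_mul_le_exp {r : ℝ} (hr : 0 < r) {y : ℝ} {a : EReal} (h : (y : EReal) ≤ a) :
    expE (-((r : EReal) * a)) ≤ Real.exp (-(r * y)) := by
  induction a with
  | bot => simp at h
  | top => simp [EReal.coe_mul_top_of_pos hr, expE, (Real.exp_pos _).le]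
  | coe a =>
    rw [← EReal.coe_mul, ← EReal.coe_neg, expE_coe]
    have := EReal.coe_le_coe_iff.1 h
    gcongr

lemma exp_le_expE_neg_mul {r : ℝ} (hr : 0 < r) {y : ℝ} {a : EReal} (ha : a ≠ ⊥)
    (h : a ≤ (y : EReal)) : Real.exp (-(r * y)) ≤ expE (-((r : EReal) * a)) := by
  induction a with
  | bot => simp at ha
  | top => simp at h
  | coe a =>
    rw [← EReal.coe_mul, ← EReal.coe_neg, expE_coe]
    have := EReal.coe_le_coe_iff.1 h
    gcongr

-- Infinite values do no harm: `(EReal.exp ⊤).toReal = 0`, so both sides vanish in each such case.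
lemma expE_neg_mul_add {r : ℝ} (hr : 0 < r) (a b : EReal) :
    expE (-((r : EReal) * (a + b))) = expE (-((r : EReal) * a)) * expE (-((r : EReal) * b)) := by
  have hbot := EReal.coe_mul_bot_of_pos hr
  have htop := EReal.coe_mul_top_of_pos hr
  induction a with
  | bot => simp [expE, hbot]
  | top => induction b <;> simp [expE, hbot, htop]
  | coe a =>
    induction b with
    | bot => simp [expE, hbot]
    | top => simp [expE, htop]
    | coe b => rw [← expE_add]; congr 1; norm_cast; ring

lemma expE_neg_mul_sum {ι : Type*} (s : Finset ι) {r : ℝ} (hr : 0 < r) (a : ι → EReal) :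
    expE (-((r : EReal) * ∑ i ∈ s, a i)) = ∏ i ∈ s, expE (-((r : EReal) * a i)) := by
  classical
  induction s using Finset.induction_on with
  | empty => simp [expE]
  | insert i s hi ih => rw [Finset.sum_insert hi, Finset.prod_insert hi, expE_neg_mul_add hr, ih]

lemma le_youngConj (ω : ℝ → ℝ) (s : ℝ) {t : ℝ} (ht : 0 ≤ t) :
    ((t * s - ω (Real.exp t) : ℝ) : EReal) ≤ youngConj ω s :=
  le_iSup₂ (f := fun t (_ : t ∈ Set.Ici (0 : ℝ)) => ((t * s - ω (Real.exp t) : ℝ) : EReal)) t ht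

lemma youngConj_le {ω : ℝ → ℝ} {s y : ℝ} (h : ∀ t, 0 ≤ t → t * s - ω (Real.exp t) ≤ y) :
    youngConj ω s ≤ y :=
  iSup₂_le fun t ht => EReal.coe_le_coe_iff.2 (h t ht)

lemma youngConj_ne_bot (ω : ℝ → ℝ) (s : ℝ) : youngConj ω s ≠ ⊥ :=
  ne_bot_of_le_ne_bot (EReal.coe_ne_bot _) (le_youngConj ω s le_rfl)

/-- The factor `exp (-r φ*(n / r))` by which derivatives and monomials of order `n` are weighted. -/
noncomputable def youngFactor (ω : ℝ → ℝ) (r : ℝ) (n : ℕ) : ℝ :=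
  expE (-((r : EReal) * youngConj ω (n / r)))

lemma youngFactor_nonneg (ω : ℝ → ℝ) (r : ℝ) (n : ℕ) : 0 ≤ youngFactor ω r n :=
  expE_nonneg _

lemma youngFactor_le_exp (ω : ℝ → ℝ) {r : ℝ} (hr : 0 < r) (n : ℕ) {t : ℝ} (ht : 0 ≤ t) :
    youngFactor ω r n ≤ Real.exp (r * ω (Real.exp t) - n * t) := by
  refine (expE_neg_mul_le_exp hr (le_youngConj ω _ ht)).trans_eq ?_
  congr 1
  field_simp
  ring

lemma exp_le_youngFactor {ω : ℝ → ℝ} {r : ℝ} (hr : 0 < r) {n : ℕ} {y : ℝ}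
    (h : ∀ t, 0 ≤ t → n * t - r * ω (Real.exp t) ≤ y) : Real.exp (-y) ≤ youngFactor ω r n := by
  have hconj : youngConj ω (n / r) ≤ (y / r : ℝ) := youngConj_le fun t ht => by
    rw [le_div_iff₀ hr]
    refine le_of_eq_of_le ?_ (h t ht)
    field_simp
  simpa [youngFactor, mul_div_cancel₀ y hr.ne'] using
    exp_le_expE_neg_mul hr (youngConj_ne_bot ω _) hconj

namespace IsWeightFunction

variable {ω : ℝ → ℝ}

lemma le_mul_one_add_add (h : IsWeightFunction ω) :
    ∃ K : ℝ, 1 ≤ K ∧ ∀ a b c : ℝ, 0 ≤ a → 0 ≤ b → 0 ≤ c → a ≤ b + c →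
      ω a ≤ K * (1 + ω b + ω c) := by
  obtain ⟨K, hK, hdoubling⟩ := h.doubling
  refine ⟨K, hK, fun a b c ha hb hc habc => ?_⟩
  wlog hbc : b ≤ c generalizing b c
  · have := this c b hc hb (by linarith) (by linarith)
    linarith
  have hmono : ω a ≤ ω (2 * c) := h.monotoneOn ha (Set.mem_Ici.2 (by linarith)) (by linarith)
  have := hdoubling c hc
  have := mul_nonneg (zero_le_one.trans hK) (h.nonneg b hb)
  linarith

lemma comp_mul_le (h : IsWeightFunction ω) (M : ℝ) :
    ∃ L : ℝ, 1 ≤ L ∧ ∀ x : ℝ, 0 ≤ x → ω (|M| * x) ≤ L * (1 + ω x) := by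
  obtain ⟨K, hK, hdoubling⟩ := h.doubling
  have two_pow : ∀ n : ℕ, ∃ L : ℝ, 1 ≤ L ∧ ∀ x : ℝ, 0 ≤ x → ω (2 ^ n * x) ≤ L * (1 + ω x) := by
    intro n
    induction n with
    | zero => exact ⟨1, le_rfl, fun x _ => by simp⟩
    | succ n ih =>
      obtain ⟨L, hL, hLx⟩ := ih
      refine ⟨K * (1 + L), by nlinarith, fun x hx => ?_⟩
      calc ω (2 ^ (n + 1) * x) ≤ K * (1 + ω (2 ^ n * x)) := by
            rw [pow_succ', mul_assoc]
            exact hdoubling _ (by positivity)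
        _ ≤ K * ((1 + L) * (1 + ω x)) := by
            have := hLx x hx
            have := h.nonneg x hx
            gcongr
            linarith
        _ = K * (1 + L) * (1 + ω x) := by ring
  obtain ⟨n, hn⟩ := pow_unbounded_of_one_lt |M| one_lt_two
  obtain ⟨L, hL, hLx⟩ := two_pow n
  exact ⟨L, hL, fun x hx => (h.monotoneOn (Set.mem_Ici.2 (by positivity))
    (Set.mem_Ici.2 (by positivity)) (by gcongr)).trans (hLx x hx)⟩

lemma le_linear (h : IsWeightFunction ω) :
    ∃ A : ℝ, 0 < A ∧ ∀ x : ℝ, 0 ≤ x → ω x ≤ A * (1 + x) := by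
  obtain ⟨R, hR⟩ := eventually_atTop.1 (h.isLittleO_id.bound one_pos)
  have hωR := h.nonneg |R| (abs_nonneg R)
  refine ⟨ω |R| + 1, by linarith, fun x hx => ?_⟩
  rcases le_total x |R| with hxR | hxR
  · have := h.monotoneOn hx (abs_nonneg R) hxR
    nlinarith
  · have := hR x ((le_abs_self R).trans hxR)
    rw [one_mul, Real.norm_of_nonneg hx] at this
    nlinarith [Real.le_norm_self (ω x)]

lemma one_add_le_exp (h : IsWeightFunction ω) :
    ∃ B c : ℝ, 0 < B ∧ 0 < c ∧ ∀ x : ℝ, 0 ≤ x → 1 + x ≤ B * Real.exp (c * ω x) := by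
  obtain ⟨a, b, hb, hab⟩ := h.log_le
  refine ⟨Real.exp (-a / b), b⁻¹, Real.exp_pos _, inv_pos.2 hb, fun x hx => ?_⟩
  rw [← Real.exp_add, ← Real.log_le_iff_le_exp (by positivity)]
  have := hab x hx
  field_simp
  linarith

lemma youngFactor_mul_pow_le (h : IsWeightFunction ω) {r : ℝ} (hr : 0 < r) (n : ℕ) {u : ℝ}
    (hu : 0 ≤ u) : youngFactor ω r n * u ^ n ≤ Real.exp (r * ω 1 + r * ω u) := by
  have hv : 1 ≤ max 1 u := le_max_left _ _
  have hv0 : 0 < max 1 u := by positivity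
  calc youngFactor ω r n * u ^ n
      ≤ Real.exp (r * ω (max 1 u) - n * Real.log (max 1 u)) * max 1 u ^ n := by
        have := youngFactor_le_exp ω hr n (Real.log_nonneg hv)
        rw [Real.exp_log hv0] at this
        gcongr
        exact le_max_right _ _
    _ = Real.exp (r * ω (max 1 u)) := by
        rw [Real.exp_sub, Real.exp_nat_mul, Real.exp_log hv0]
        field_simp
    _ ≤ Real.exp (r * ω 1 + r * ω u) := by
        have := mul_nonneg hr.le (h.nonneg 1 zero_le_one)
        have := mul_nonneg hr.le (h.nonneg u hu)
        gcongr
        rcases le_total 1 u with h1u | hu1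
        · rw [max_eq_right h1u]; linarith
        · rw [max_eq_left hu1]; linarith

lemma one_le_youngFactor_zero (h : IsWeightFunction ω) {r : ℝ} (hr : 0 < r) :
    1 ≤ youngFactor ω r 0 := by
  simpa using exp_le_youngFactor (n := 0) hr (y := 0) fun t _ => by
    simpa using mul_nonneg hr.le (h.nonneg _ (Real.exp_pos t).le)

-- `n` is the integer part of a subgradient of `t ↦ c ω(e^t)` at `log u`; the gain `exp (-n)` comes
-- from comparing `ω(e^t)` with `ω(e^(t+1))`.
lemma exists_exp_le_pow_mul_youngFactor (h : IsWeightFunction ω) :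
    ∃ L : ℝ, 1 ≤ L ∧ ∀ c : ℝ, 0 < c → ∀ u : ℝ, 1 ≤ u → ∃ n : ℕ, ∀ r, c * L ≤ r →
      Real.exp (c * ω u) ≤
        Real.exp (c * L) * (Real.exp (-n) * (u ^ (n + 1) * youngFactor ω r n)) := by
  obtain ⟨L, hL, hLx⟩ := h.comp_mul_le (Real.exp 1)
  rw [abs_of_pos (Real.exp_pos 1)] at hLx
  refine ⟨L, hL, fun c hc u hu => ?_⟩
  have hmono : Monotone fun t => ω (Real.exp t) := fun a b hab =>
    h.monotoneOn (Real.exp_pos a).le (Real.exp_pos b).le (Real.exp_le_exp.2 hab)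
  obtain ⟨s, hs, hsub⟩ :=
    exists_nonneg_subgradient_of_monotone h.convex_comp_exp hmono (Real.log u)
  have hu0 : 0 < u := by positivity
  have hlog : 0 ≤ Real.log u := Real.log_nonneg hu
  simp only [Real.exp_log hu0] at hsub
  set n := ⌊c * s⌋₊
  have hn_le : (n : ℝ) ≤ c * s := Nat.floor_le (by positivity)
  have hle_n : c * s ≤ n + 1 := (Nat.lt_floor_add_one _).le
  refine ⟨n, fun r hr => ?_⟩
  have hr0 : 0 < r := lt_of_lt_of_le (by positivity) hr
  have hconj : ∀ t, 0 ≤ t →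
      n * t - r * ω (Real.exp t) ≤ c * L - c * ω u - n + (n + 1) * Real.log u := by
    intro t ht
    have hshift := (hsub (1 + t)).trans_eq (congrArg ω (Real.exp_add 1 t)) |>.trans
      (hLx _ (Real.exp_pos t).le)
    have := mul_le_mul_of_nonneg_left hshift hc.le
    have := mul_le_mul_of_nonneg_right hr (h.nonneg _ (Real.exp_pos t).le)
    have := mul_le_mul_of_nonneg_right hn_le (by linarith : 0 ≤ 1 + t)
    have := mul_le_mul_of_nonneg_right hle_n hlog
    linarith
  calc Real.exp (c * ω u)
      = Real.exp (c * L) * (Real.exp (-n) * (u ^ (n + 1) *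
          Real.exp (-(c * L - c * ω u - n + (n + 1) * Real.log u)))) := by
        rw [show u ^ (n + 1) = Real.exp ((n + 1 : ℕ) * Real.log u) by
          rw [Real.exp_nat_mul, Real.exp_log hu0]]
        simp only [← Real.exp_add]
        push_cast
        ring_nf
    _ ≤ _ := by gcongr; exact exp_le_youngFactor hr0 hconj

lemma exists_exp_le_exp_neg_mul_pow_mul_youngFactor (h : IsWeightFunction ω) {r : ℝ}
    (hr : 0 < r) : ∃ s₀ C : ℝ, 0 < s₀ ∧ 0 < C ∧ ∀ s, s₀ ≤ s → ∀ u : ℝ, 0 ≤ u → ∃ n : ℕ,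
      Real.exp (r * ω u) ≤ C * (Real.exp (-n) * (u ^ n * youngFactor ω s n)) := by
  obtain ⟨B, c, hB, hc, hBc⟩ := h.one_add_le_exp
  obtain ⟨L, hL, hyoung⟩ := h.exists_exp_le_pow_mul_youngFactor
  refine ⟨(r + c) * L, max (Real.exp (r * ω 1)) (B * Real.exp ((r + c) * L)), by positivity,
    lt_max_of_lt_left (Real.exp_pos _), fun s hs u hu => ?_⟩
  have hs0 : 0 < s := lt_of_lt_of_le (by positivity) hs
  rcases le_total u 1 with hu1 | hu1
  · refine ⟨0, ?_⟩
    calc Real.exp (r * ω u) ≤ Real.exp (r * ω 1) * 1 := by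
          rw [mul_one]
          gcongr
          exact h.monotoneOn hu (Set.mem_Ici.2 zero_le_one) hu1
      _ ≤ _ := by
          simp only [Nat.cast_zero, neg_zero, Real.exp_zero, pow_zero, one_mul]
          gcongr
          · exact le_max_left _ _
          · exact h.one_le_youngFactor_zero hs0
  · obtain ⟨n, hn⟩ := hyoung (r + c) (by positivity) u hu1
    refine ⟨n, ?_⟩
    have hfactor := youngFactor_nonneg ω s n
    have hu_le : u ≤ B * Real.exp (c * ω u) := by linarith [hBc u hu]
    calc Real.exp (r * ω u) = Real.exp ((r + c) * ω u) * Real.exp (-(c * ω u)) := by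
          rw [← Real.exp_add]; ring_nf
      _ ≤ Real.exp ((r + c) * L) * (Real.exp (-n) *
            (u ^ n * (B * Real.exp (c * ω u)) * youngFactor ω s n)) * Real.exp (-(c * ω u)) := by
          have := hn s hs
          rw [pow_succ] at this
          refine mul_le_mul_of_nonneg_right (this.trans ?_) (Real.exp_pos _).le
          gcongr
      _ = B * Real.exp ((r + c) * L) * (Real.exp (-n) * (u ^ n * youngFactor ω s n)) := by
          rw [Real.exp_neg (c * ω u)]
          field_simp
      _ ≤ _ := by gcongr; exact le_max_right _ _

lemma exists_youngFactor_pos (h : IsWeightFunction ω) (n : ℕ) :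
    ∃ R : ℝ, 0 < R ∧ ∀ r, R ≤ r → 0 < youngFactor ω r n := by
  obtain ⟨a, b, hb, hab⟩ := h.log_le
  refine ⟨(n + 1) / b, by positivity, fun r hr => ?_⟩
  have hr0 : 0 < r := lt_of_lt_of_le (by positivity) hr
  have hrb : n ≤ r * b := by linarith [(div_le_iff₀ hb).1 hr]
  refine (Real.exp_pos _).trans_le (exp_le_youngFactor hr0 (y := -(r * a)) fun t ht => ?_)
  have ht_le : t ≤ Real.log (1 + Real.exp t) := by
    rw [Real.le_log_iff_exp_le (by positivity)]; linarith
  nlinarith [hab _ (Real.exp_pos t).le, mul_le_mul_of_nonneg_right hrb ht,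
    mul_le_mul_of_nonneg_left ht_le hb.le]

end IsWeightFunction

/-- The properties of a weight `Ω` on a normed space on which the time-frequency argument rests:
quasi-subadditivity, stability under dilations, and growth between logarithmic and linear. -/
structure IsModerateWeight {V : Type*} [NormedAddCommGroup V] [NormedSpace ℝ V]
    (Ω : V → ℝ) : Prop where
  continuous : Continuous Ω
  nonneg : ∀ x, 0 ≤ Ω x
  add_le : ∃ K : ℝ, 1 ≤ K ∧ ∀ x y, Ω (x + y) ≤ K * (1 + Ω x + Ω y)
  smul_le : ∀ M : ℝ, ∃ L : ℝ, 1 ≤ L ∧ ∀ x, Ω (M • x) ≤ L * (1 + Ω x)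
  le_linear : ∃ A : ℝ, 0 < A ∧ ∀ x, Ω x ≤ A * (1 + ‖x‖)
  one_add_norm_le_exp : ∃ B c : ℝ, 0 < B ∧ 0 < c ∧ ∀ x, 1 + ‖x‖ ≤ B * Real.exp (c * Ω x)

/-- `g = O(exp (-r Ω))` for every `r > 0`. -/
def RapidDecay {V F : Type*} [NormedAddCommGroup F] (Ω : V → ℝ) (g : V → F) : Prop :=
  ∀ r : ℝ, 0 < r → ∃ C : ℝ, 0 < C ∧ ∀ x, ‖g x‖ ≤ C * Real.exp (-(r * Ω x))

lemma exists_norm_le_and_norm_sub_le {E F : Type*} [NormedAddCommGroup E] [NormedSpace ℝ E]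
    [NormedAddCommGroup F] [NormedSpace ℝ F] (f : 𝓢(E, F)) :
    ∃ M : ℝ, 0 < M ∧ (∀ x, ‖f x‖ ≤ M) ∧ ∀ x y, ‖f x - f y‖ ≤ M * ‖x - y‖ := by
  obtain ⟨C₀, hC₀, h₀⟩ := f.decay 0 0
  obtain ⟨C₁, hC₁, h₁⟩ := f.decay 0 1
  simp only [pow_zero, one_mul, norm_iteratedFDeriv_zero, norm_iteratedFDeriv_one] at h₀ h₁
  exact ⟨C₀ + C₁, by positivity, fun x => by linarith [h₀ x], fun x y =>
    convex_univ.norm_image_sub_le_of_norm_fderiv_le (𝕜 := ℝ) (fun z _ => f.differentiableAt)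
      (fun z _ => by linarith [h₁ z]) trivial trivial⟩

lemma RapidDecay.exp_mul_norm_le {V F : Type*} [NormedAddCommGroup F] {Ω : V → ℝ} {g : V → F}
    (hg : RapidDecay Ω g) {r c : ℝ} (hrc : 0 < r + c) :
    ∃ C : ℝ, 0 < C ∧ ∀ x, Real.exp (r * Ω x) * ‖g x‖ ≤ C * Real.exp (-(c * Ω x)) := by
  obtain ⟨C, hC, hgC⟩ := hg (r + c) hrc
  refine ⟨C, hC, fun x => ?_⟩
  calc Real.exp (r * Ω x) * ‖g x‖ ≤ Real.exp (r * Ω x) * (C * Real.exp (-((r + c) * Ω x))) := by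
        gcongr
        exact hgC x
    _ = C * Real.exp (-(c * Ω x)) := by
        rw [mul_left_comm, ← Real.exp_add]
        ring_nf

section FiniteDimensional

variable {V : Type*} [NormedAddCommGroup V] [NormedSpace ℝ V] [FiniteDimensional ℝ V]
  [MeasurableSpace V] [BorelSpace V] (μ : Measure V) [μ.IsAddHaarMeasure]

-- `‖f‖ ≥ ‖f x‖ / 2` on the ball of radius `‖f x‖ / (2 M) ≤ 1` around `x`.
lemma pow_norm_mul_measure_ball_le {F : Type*} [NormedAddCommGroup F] {f : V → F} {M : ℝ}
    (hM : 0 < M) (hbound : ∀ x, ‖f x‖ ≤ M) (hlip : ∀ x y, ‖f x - f y‖ ≤ M * ‖x - y‖) {x : V}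
    (hint : IntegrableOn f (Metric.ball x 1) μ) :
    ‖f x‖ ^ (Module.finrank ℝ V + 1) * μ.real (Metric.ball 0 1) ≤
      2 * (2 * M) ^ Module.finrank ℝ V * ∫ y in Metric.ball x 1, ‖f y‖ ∂μ := by
  rcases (norm_nonneg (f x)).eq_or_lt with h0 | hpos
  · rw [← h0, zero_pow (Nat.succ_ne_zero _), zero_mul]
    positivity
  set ρ := ‖f x‖ / (2 * M) with hρ
  have hρ0 : 0 < ρ := by positivity
  have hsub : Metric.ball x ρ ⊆ Metric.ball x 1 := by
    refine Metric.ball_subset_ball ((div_le_one (by positivity)).2 ?_)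
    linarith [hbound x]
  have half_le : ∀ y ∈ Metric.ball x ρ, ‖f x‖ / 2 ≤ ‖f y‖ := by
    intro y hy
    have hxy : M * ‖x - y‖ ≤ ‖f x‖ / 2 := by
      calc M * ‖x - y‖ ≤ M * ρ := by
            gcongr
            rw [← dist_eq_norm, dist_comm]
            exact (Metric.mem_ball.1 hy).le
        _ = ‖f x‖ / 2 := by rw [hρ]; field_simp
    linarith [norm_sub_norm_le (f x) (f y), hlip x y]
  have hvol : μ.real (Metric.ball x ρ) = ρ ^ Module.finrank ℝ V * μ.real (Metric.ball 0 1) := by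
    rw [Measure.real, Measure.addHaar_ball_of_pos _ _ hρ0, ENNReal.toReal_mul,
      ENNReal.toReal_ofReal (by positivity), Measure.real]
  calc ‖f x‖ ^ (Module.finrank ℝ V + 1) * μ.real (Metric.ball 0 1)
      = 2 * (2 * M) ^ Module.finrank ℝ V * (‖f x‖ / 2 * μ.real (Metric.ball x ρ)) := by
        rw [hvol, hρ, div_pow]
        field_simp
        ring
    _ ≤ 2 * (2 * M) ^ Module.finrank ℝ V * ∫ y in Metric.ball x ρ, ‖f y‖ ∂μ := by
        gcongr
        exact setIntegral_ge_of_const_le_real Metric.isOpen_ball.measurableSet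
          measure_ball_lt_top.ne half_le (IntegrableOn.mono_set hint.norm hsub)
    _ ≤ 2 * (2 * M) ^ Module.finrank ℝ V * ∫ y in Metric.ball x 1, ‖f y‖ ∂μ := by
        gcongr ?_ * ?_
        exact setIntegral_mono_set hint.norm (ae_of_all _ fun y => norm_nonneg _)
          (Eventually.of_forall hsub)

end FiniteDimensional

section ModerateWeight

variable {V : Type*} [NormedAddCommGroup V] [NormedSpace ℝ V] {Ω : V → ℝ}

lemma RapidDecay.comp_smul {F : Type*} [NormedAddCommGroup F] (hΩ : IsModerateWeight Ω)
    {g : V → F} (hg : RapidDecay Ω g) {a : ℝ} (ha : a ≠ 0) : RapidDecay Ω fun x => g (a • x) := by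
  intro r hr
  obtain ⟨L, hL, hLx⟩ := hΩ.smul_le a⁻¹
  obtain ⟨C, hC, hgC⟩ := hg (r * L) (by positivity)
  refine ⟨C * Real.exp (r * L), by positivity, fun x => (hgC (a • x)).trans ?_⟩
  rw [mul_assoc C, ← Real.exp_add]
  gcongr
  have := mul_le_mul_of_nonneg_left (hLx (a • x)) hr.le
  rw [inv_smul_smul₀ ha] at this
  linarith

namespace IsModerateWeight

lemma exists_le_of_norm_sub_le_one (hΩ : IsModerateWeight Ω) :
    ∃ K A : ℝ, 1 ≤ K ∧ 0 ≤ A ∧ ∀ x y, ‖x - y‖ ≤ 1 → Ω x ≤ K * Ω y + A := by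
  obtain ⟨K, hK, hadd⟩ := hΩ.add_le
  obtain ⟨A, hA, hlin⟩ := hΩ.le_linear
  refine ⟨K, K * (1 + A * 2), hK, by positivity, fun x y hxy => ?_⟩
  calc Ω x = Ω (y + (x - y)) := by rw [add_sub_cancel]
    _ ≤ K * (1 + Ω y + Ω (x - y)) := hadd _ _
    _ ≤ K * (1 + Ω y + A * 2) := by
        gcongr
        refine (hlin _).trans ?_
        gcongr
        linarith
    _ = K * Ω y + K * (1 + A * 2) := by ring

variable [MeasurableSpace V] [BorelSpace V]

lemma exists_setIntegral_ball_norm_le (hΩ : IsModerateWeight Ω) {μ : Measure V}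
    {F : Type*} [NormedAddCommGroup F] {f : V → F} (hf : Integrable f μ)
    (hexp : ∀ r : ℝ, 0 < r → Integrable (fun x => Real.exp (r * Ω x) * ‖f x‖) μ) {r : ℝ}
    (hr : 0 < r) : ∃ C : ℝ, 0 ≤ C ∧ ∀ x,
      ∫ y in Metric.ball x 1, ‖f y‖ ∂μ ≤ C * Real.exp (-(r * Ω x)) := by
  obtain ⟨K, A, hK, _, hΩK⟩ := hΩ.exists_le_of_norm_sub_le_one
  refine ⟨Real.exp (r * A) * ∫ y, Real.exp (r * K * Ω y) * ‖f y‖ ∂μ,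
    mul_nonneg (Real.exp_pos _).le (integral_nonneg fun y => by positivity), fun x => ?_⟩
  have hint := (hexp (r * K) (by positivity)).const_mul (Real.exp (r * A - r * Ω x))
  calc ∫ y in Metric.ball x 1, ‖f y‖ ∂μ
      ≤ ∫ y in Metric.ball x 1,
          Real.exp (r * A - r * Ω x) * (Real.exp (r * K * Ω y) * ‖f y‖) ∂μ := by
        refine setIntegral_mono_on hf.norm.integrableOn hint.integrableOn
          Metric.isOpen_ball.measurableSet fun y hy => ?_
        rw [← mul_assoc, ← Real.exp_add]
        refine le_mul_of_one_le_left (norm_nonneg _) (Real.one_le_exp ?_)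
        have := hΩK x y (by rw [← dist_eq_norm, dist_comm]; exact (Metric.mem_ball.1 hy).le)
        nlinarith
    _ ≤ ∫ y, Real.exp (r * A - r * Ω x) * (Real.exp (r * K * Ω y) * ‖f y‖) ∂μ :=
        setIntegral_le_integral hint (ae_of_all _ fun y => by positivity)
    _ = (Real.exp (r * A) * ∫ y, Real.exp (r * K * Ω y) * ‖f y‖ ∂μ) * Real.exp (-(r * Ω x)) := by
        rw [integral_const_mul, sub_eq_add_neg, Real.exp_add]
        ring

variable [FiniteDimensional ℝ V] (μ : Measure V) [μ.IsAddHaarMeasure]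

lemma exists_integrable_exp_neg (hΩ : IsModerateWeight Ω) :
    ∃ c : ℝ, 0 < c ∧ Integrable (fun x => Real.exp (-(c * Ω x))) μ := by
  obtain ⟨B, c, hB, hc, hexp⟩ := hΩ.one_add_norm_le_exp
  have hcont := hΩ.continuous
  set m : ℝ := Module.finrank ℝ V + 1
  have : 0 < m := by positivity
  refine ⟨m * c, by positivity, ((integrable_one_add_norm (μ := μ) (lt_add_one _)).const_mul
    (B ^ m)).mono' (by fun_prop) (ae_of_all _ fun x => ?_)⟩
  have hpos : 0 < 1 + ‖x‖ := by positivity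
  rw [Real.norm_of_nonneg (Real.exp_pos _).le, Real.rpow_neg hpos.le, Real.exp_neg,
    ← div_eq_mul_inv, ← one_div, div_le_div_iff₀ (Real.exp_pos _) (by positivity), one_mul]
  calc (1 + ‖x‖) ^ m ≤ (B * Real.exp (c * Ω x)) ^ m := by gcongr; exact hexp x
    _ = B ^ m * Real.exp (m * c * Ω x) := by
        rw [Real.mul_rpow hB.le (Real.exp_pos _).le, ← Real.exp_mul]
        ring_nf

lemma exists_memLp_exp_neg (hΩ : IsModerateWeight Ω) :
    ∃ c : ℝ, 0 < c ∧ ∀ p : ℝ≥0∞, 1 ≤ p → MemLp (fun x => Real.exp (-(c * Ω x))) p μ := by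
  obtain ⟨c, hc, hint⟩ := hΩ.exists_integrable_exp_neg μ
  have hle : ∀ x, Real.exp (-(c * Ω x)) ≤ 1 := fun x =>
    Real.exp_le_one_iff.2 (neg_nonpos.2 (mul_nonneg hc.le (hΩ.nonneg x)))
  have := hΩ.continuous
  refine ⟨c, hc, fun p hp => ?_⟩
  rcases eq_or_ne p ∞ with rfl | hp_top
  · exact memLp_top_of_bound hint.1 1 (ae_of_all _ fun x => by simpa using hle x)
  rw [← integrable_norm_rpow_iff hint.1 (by positivity) hp_top]
  refine hint.mono' (hint.1.norm.aemeasurable.pow_const _).aestronglyMeasurable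
    (ae_of_all _ fun x => ?_)
  rw [Real.norm_of_nonneg (Real.exp_pos _).le,
    Real.norm_of_nonneg (Real.rpow_nonneg (Real.exp_pos _).le _)]
  exact (Real.rpow_le_rpow_of_exponent_ge (Real.exp_pos _) (hle x)
    (by simpa using ENNReal.toReal_mono hp_top hp)).trans_eq (Real.rpow_one _)

lemma exists_eLpNorm_le_of_norm_le (hΩ : IsModerateWeight Ω) {p : ℝ≥0∞} (hp : 1 ≤ p) :
    ∃ A c : ℝ, 0 < A ∧ 0 < c ∧ ∀ (g : V → ℂ) (C : ℝ), 0 ≤ C →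
      (∀ x, ‖g x‖ ≤ C * Real.exp (-(c * Ω x))) → eLpNorm g p μ ≤ ENNReal.ofReal (C * A) := by
  obtain ⟨c, hc, hmem⟩ := hΩ.exists_memLp_exp_neg μ
  refine ⟨(eLpNorm (fun x => Real.exp (-(c * Ω x))) p μ).toReal + 1, c, by positivity, hc,
    fun g C hC hg => ?_⟩
  calc eLpNorm g p μ ≤ ENNReal.ofReal C * eLpNorm (fun x => Real.exp (-(c * Ω x))) p μ :=
        eLpNorm_le_mul_eLpNorm_of_ae_le_mul
          (ae_of_all _ fun x => by simpa [abs_of_pos (Real.exp_pos _)] using hg x) p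
    _ ≤ _ := by
        rw [ENNReal.ofReal_mul hC]
        gcongr
        exact (ENNReal.le_ofReal_iff_toReal_le (hmem p hp).eLpNorm_ne_top (by positivity)).2
          (le_add_of_nonneg_right zero_le_one)

lemma exists_eLpNorm_one_exp_neg_mul_le (hΩ : IsModerateWeight Ω) {p : ℝ≥0∞} (hp : 1 ≤ p) :
    ∃ A c : ℝ, 0 < A ∧ 0 < c ∧ ∀ g : V → ℂ, AEStronglyMeasurable g μ →
      eLpNorm (fun x => (Real.exp (-(c * Ω x)) : ℂ) * g x) 1 μ ≤
        ENNReal.ofReal A * eLpNorm g p μ := by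
  obtain ⟨c, hc, hmem⟩ := hΩ.exists_memLp_exp_neg μ
  have hconj := ENNReal.HolderConjugate.conjExponent hp
  have hw := hmem p.conjExponent hconj.symm.one_le
  have : ENNReal.HolderTriple p.conjExponent p 1 := hconj.symm
  refine ⟨(eLpNorm (fun x => Real.exp (-(c * Ω x))) p.conjExponent μ).toReal + 1, c,
    by positivity, hc, fun g hg => ?_⟩
  calc eLpNorm (fun x => (Real.exp (-(c * Ω x)) : ℂ) * g x) 1 μ
      = eLpNorm ((fun x => Real.exp (-(c * Ω x))) • g) 1 μ := rfl
    _ ≤ eLpNorm (fun x => Real.exp (-(c * Ω x))) p.conjExponent μ * eLpNorm g p μ :=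
        eLpNorm_smul_le_mul_eLpNorm hg hw.1
    _ ≤ _ := by
        gcongr
        exact (ENNReal.le_ofReal_iff_toReal_le hw.eLpNorm_ne_top (by positivity)).2
          (le_add_of_nonneg_right zero_le_one)

lemma integrable_exp_mul_norm (hΩ : IsModerateWeight Ω) {p : ℝ≥0∞} (hp : 1 ≤ p) {g : V → ℂ}
    (hg : Continuous g) (h : ∀ r : ℝ, 0 < r →
      eLpNorm (fun x => (Real.exp (r * Ω x) : ℂ) * g x) p μ < ∞) {r : ℝ} (hr : 0 < r) :
    Integrable (fun x => Real.exp (r * Ω x) * ‖g x‖) μ := by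
  obtain ⟨A, c, _, hc, hHolder⟩ := hΩ.exists_eLpNorm_one_exp_neg_mul_le μ hp
  have hcont := hΩ.continuous
  have hmeas : Continuous fun x => (Real.exp ((r + c) * Ω x) : ℂ) * g x := by fun_prop
  have hmem : MemLp (fun x => (Real.exp (-(c * Ω x)) : ℂ) *
      ((Real.exp ((r + c) * Ω x) : ℂ) * g x)) 1 μ :=
    ⟨by fun_prop, (hHolder _ hmeas.aestronglyMeasurable).trans_lt
      (ENNReal.mul_lt_top ENNReal.ofReal_lt_top (h _ (by positivity)))⟩
  refine (memLp_one_iff_integrable.1 hmem).norm.congr (ae_of_all _ fun x => ?_)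
  simp only [norm_mul, Complex.norm_real, Real.norm_of_nonneg (Real.exp_pos _).le]
  rw [← mul_assoc, ← Real.exp_add]
  ring_nf

end IsModerateWeight

variable [FiniteDimensional ℝ V] [MeasurableSpace V] [BorelSpace V]
  (μ : Measure V) [μ.IsAddHaarMeasure]

lemma RapidDecay.eLpNorm_exp_mul_lt_top (hΩ : IsModerateWeight Ω) {p : ℝ≥0∞} (hp : 1 ≤ p)
    {g : V → ℂ} (hg : RapidDecay Ω g) {r : ℝ} (hr : 0 < r) :
    eLpNorm (fun x => (Real.exp (r * Ω x) : ℂ) * g x) p μ < ∞ := by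
  obtain ⟨A, c, _, hc, hle⟩ := hΩ.exists_eLpNorm_le_of_norm_le μ hp
  obtain ⟨C, hC, hgC⟩ := hg.exp_mul_norm_le (r := r) (c := c) (by positivity)
  exact (hle _ C hC.le fun x => by
    simpa only [norm_mul, Complex.norm_real, Real.norm_of_nonneg (Real.exp_pos _).le]
      using hgC x).trans_lt ENNReal.ofReal_lt_top

lemma rapidDecay_of_integrable_exp_mul (hΩ : IsModerateWeight Ω) {F : Type*}
    [NormedAddCommGroup F] [NormedSpace ℝ F] (f : 𝓢(V, F))
    (hf : ∀ r : ℝ, 0 < r → Integrable (fun x => Real.exp (r * Ω x) * ‖f x‖) μ) :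
    RapidDecay Ω f := by
  intro r hr
  obtain ⟨M, hM, hbound, hlip⟩ := exists_norm_le_and_norm_sub_le f
  set d := Module.finrank ℝ V
  obtain ⟨I, _, hle⟩ := hΩ.exists_setIntegral_ball_norm_le f.integrable hf
    (r := (d + 1 : ℕ) * r) (by positivity)
  have hball : 0 < μ.real (Metric.ball (0 : V) 1) :=
    ENNReal.toReal_pos (Metric.measure_ball_pos _ _ one_pos).ne' measure_ball_lt_top.ne
  set C := 2 * (2 * M) ^ d * I / μ.real (Metric.ball (0 : V) 1)
  refine ⟨max 1 C, by positivity, fun x => ?_⟩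
  refine le_of_pow_le_pow_left₀ (Nat.succ_ne_zero d) (by positivity) ?_
  calc ‖f x‖ ^ (d + 1) ≤ C * Real.exp (-((d + 1 : ℕ) * r * Ω x)) := by
        rw [div_mul_eq_mul_div, le_div_iff₀ hball]
        refine (pow_norm_mul_measure_ball_le μ hM hbound hlip f.integrable.integrableOn).trans ?_
        rw [mul_assoc (2 * (2 * M) ^ d)]
        gcongr
        exact hle x
    _ ≤ max 1 C ^ (d + 1) * Real.exp (-(r * Ω x)) ^ (d + 1) := by
        rw [← Real.exp_nat_mul, mul_neg, mul_assoc ((d + 1 : ℕ) : ℝ)]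
        gcongr
        exact (le_max_right 1 C).trans (le_self_pow₀ (le_max_left _ _) (Nat.succ_ne_zero d))
    _ = (max 1 C * Real.exp (-(r * Ω x))) ^ (d + 1) := (mul_pow _ _ _).symm

lemma rapidDecay_iff_eLpNorm_exp_mul_lt_top (hΩ : IsModerateWeight Ω) {p : ℝ≥0∞} (hp : 1 ≤ p)
    (f : 𝓢(V, ℂ)) : RapidDecay Ω f ↔
      ∀ r : ℝ, 0 < r → eLpNorm (fun x => (Real.exp (r * Ω x) : ℂ) * f x) p μ < ∞ :=
  ⟨fun hf _ hr => hf.eLpNorm_exp_mul_lt_top μ hΩ hp hr, fun h =>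
    rapidDecay_of_integrable_exp_mul μ hΩ f fun _ hr =>
      hΩ.integrable_exp_mul_norm μ hp f.continuous h hr⟩

end ModerateWeight

section SumWeight

variable {N : ℕ} {ω : Fin N → ℝ → ℝ}

lemma sumWeight_nonneg (hω : ∀ j, IsWeightFunction (ω j)) (x : EuclideanSpace ℝ (Fin N)) :
    0 ≤ sumWeight ω x :=
  Finset.sum_nonneg fun j _ => (hω j).nonneg _ (abs_nonneg _)

lemma single_le_sumWeight (hω : ∀ j, IsWeightFunction (ω j)) (j : Fin N)
    (x : EuclideanSpace ℝ (Fin N)) : ω j |x j| ≤ sumWeight ω x :=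
  Finset.single_le_sum (f := fun j => ω j |x j|) (fun i _ => (hω i).nonneg _ (abs_nonneg _))
    (Finset.mem_univ j)

lemma norm_le_sum_abs (x : EuclideanSpace ℝ (Fin N)) : ‖x‖ ≤ ∑ j, |x j| := by
  conv_lhs => rw [← (EuclideanSpace.basisFun (Fin N) ℝ).sum_repr x]
  exact (norm_sum_le _ _).trans_eq (Finset.sum_congr rfl fun j _ => by simp [norm_smul])

lemma exists_sumWeight_le_mul {X : Type*} {u : X → EuclideanSpace ℝ (Fin N)} {b : X → ℝ}
    (hb : ∀ t, 0 ≤ b t) (h : ∀ j, ∃ K : ℝ, ∀ t, ω j |u t j| ≤ K * b t) :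
    ∃ K : ℝ, 1 ≤ K ∧ ∀ t, sumWeight ω (u t) ≤ K * b t := by
  choose K hK using h
  refine ⟨1 + ∑ j, |K j|, le_add_of_nonneg_right (by positivity), fun t => ?_⟩
  calc sumWeight ω (u t) ≤ ∑ j, |K j| * b t := Finset.sum_le_sum fun j _ =>
        (hK j t).trans (mul_le_mul_of_nonneg_right (le_abs_self _) (hb t))
    _ ≤ (1 + ∑ j, |K j|) * b t := by
        rw [← Finset.sum_mul]
        exact mul_le_mul_of_nonneg_right (le_add_of_nonneg_left zero_le_one) (hb t)

lemma exists_one_add_norm_le_exp_sumWeight (hω : ∀ j, IsWeightFunction (ω j)) :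
    ∃ B c : ℝ, 0 < B ∧ 0 < c ∧ ∀ x, 1 + ‖x‖ ≤ B * Real.exp (c * sumWeight ω x) := by
  choose B c hB _ hBc using fun j => (hω j).one_add_le_exp
  obtain ⟨c', hc'⟩ := Finite.exists_le c
  have hmax : 0 < max 1 c' := by positivity
  have hsum : 0 ≤ ∑ j, B j := Finset.sum_nonneg fun j _ => (hB j).le
  refine ⟨1 + ∑ j, B j, max 1 c', by positivity, hmax, fun x => ?_⟩
  have hcoord : ∀ j, |x j| ≤ B j * Real.exp (max 1 c' * sumWeight ω x) := fun j => by
    have hωj := (hω j).nonneg _ (abs_nonneg (x j))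
    calc |x j| ≤ B j * Real.exp (c j * ω j |x j|) := by linarith [hBc j _ (abs_nonneg (x j))]
      _ ≤ _ := by
        have := (hB j).le
        gcongr
        · exact (hc' j).trans (le_max_right _ _)
        · exact single_le_sumWeight hω j x
  have hΩ := sumWeight_nonneg hω x
  calc 1 + ‖x‖ ≤ Real.exp (max 1 c' * sumWeight ω x) +
        ∑ j, B j * Real.exp (max 1 c' * sumWeight ω x) :=
        add_le_add (Real.one_le_exp (by positivity))
          ((norm_le_sum_abs x).trans (Finset.sum_le_sum fun j _ => hcoord j))
    _ = _ := by rw [← Finset.sum_mul]; ring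

lemma isModerateWeight_sumWeight (hω : ∀ j, IsWeightFunction (ω j)) :
    IsModerateWeight (sumWeight ω) where
  continuous := continuous_finsetSum _ fun j _ =>
    (hω j).continuousOn.comp_continuous (by fun_prop) fun _ => Set.mem_Ici.2 (abs_nonneg _)
  nonneg := sumWeight_nonneg hω
  add_le := by
    obtain ⟨K, hK, hKxy⟩ := exists_sumWeight_le_mul (ω := ω)
      (u := fun t : EuclideanSpace ℝ (Fin N) × EuclideanSpace ℝ (Fin N) => t.1 + t.2)
      (b := fun t => 1 + sumWeight ω t.1 + sumWeight ω t.2)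
      (fun t => by linarith [sumWeight_nonneg hω t.1, sumWeight_nonneg hω t.2]) fun j => by
        obtain ⟨K, hK, hKx⟩ := (hω j).le_mul_one_add_add
        refine ⟨K, fun t => (hKx _ _ _ (abs_nonneg _) (abs_nonneg _) (abs_nonneg _)
          (abs_add_le (t.1 j) (t.2 j))).trans ?_⟩
        gcongr <;> exact single_le_sumWeight hω j _
    exact ⟨K, hK, fun x y => hKxy (x, y)⟩
  smul_le M := by
    refine exists_sumWeight_le_mul (fun x => by linarith [sumWeight_nonneg hω x]) fun j => ?_
    obtain ⟨L, hL, hLx⟩ := (hω j).comp_mul_le M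
    refine ⟨L, fun x => ?_⟩
    rw [PiLp.smul_apply, smul_eq_mul, abs_mul]
    refine (hLx _ (abs_nonneg _)).trans ?_
    gcongr
    exact single_le_sumWeight hω j x
  le_linear := by
    obtain ⟨A, hA, hAx⟩ := exists_sumWeight_le_mul (ω := ω) (u := id) (b := fun x => 1 + ‖x‖)
      (fun x => by positivity) fun j => by
        obtain ⟨A, _, hAx⟩ := (hω j).le_linear
        refine ⟨A, fun x => (hAx _ (abs_nonneg _)).trans ?_⟩
        gcongr
        exact PiLp.norm_apply_le x j
    exact ⟨A, zero_lt_one.trans_le hA, hAx⟩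
  one_add_norm_le_exp := exists_one_add_norm_le_exp_sumWeight hω

/-- The factor `exp (-r Ω*(β / r))` of conditions (5) and (6). -/
noncomputable def sumYoungFactor (ω : Fin N → ℝ → ℝ) (r : ℝ) (β : Fin N → ℕ) : ℝ :=
  expE (-((r : EReal) * sumYoungConj ω (fun j => (β j : ℝ) / r)))

lemma sumYoungFactor_nonneg (ω : Fin N → ℝ → ℝ) (r : ℝ) (β : Fin N → ℕ) :
    0 ≤ sumYoungFactor ω r β :=
  expE_nonneg _

lemma sumYoungFactor_eq_prod (ω : Fin N → ℝ → ℝ) {r : ℝ} (hr : 0 < r) (β : Fin N → ℕ) :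
    sumYoungFactor ω r β = ∏ j, youngFactor (ω j) r (β j) :=
  expE_neg_mul_sum Finset.univ hr _

lemma sumYoungFactor_mul_prod_le (hω : ∀ j, IsWeightFunction (ω j)) {r : ℝ} (hr : 0 < r) :
    ∃ C : ℝ, 0 < C ∧ ∀ (β : Fin N → ℕ) (x : EuclideanSpace ℝ (Fin N)),
      sumYoungFactor ω r β * ∏ j, |x j| ^ β j ≤ C * Real.exp (r * sumWeight ω x) := by
  refine ⟨Real.exp (∑ j, r * ω j 1), Real.exp_pos _, fun β x => ?_⟩
  rw [sumYoungFactor_eq_prod ω hr, ← Finset.prod_mul_distrib, sumWeight, Finset.mul_sum,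
    ← Real.exp_add, ← Finset.sum_add_distrib, Real.exp_sum]
  exact Finset.prod_le_prod
    (fun j _ => mul_nonneg (youngFactor_nonneg _ _ _) (by positivity))
    fun j _ => (hω j).youngFactor_mul_pow_le hr _ (abs_nonneg _)

lemma exists_exp_sumWeight_le_sumYoungFactor (hω : ∀ j, IsWeightFunction (ω j)) {r : ℝ}
    (hr : 0 < r) : ∃ s C : ℝ, 0 < s ∧ 0 < C ∧ ∀ x : EuclideanSpace ℝ (Fin N), ∃ β : Fin N → ℕ,
      Real.exp (r * sumWeight ω x) ≤
        C * ((∏ j, Real.exp (-(β j : ℝ))) * ((∏ j, |x j| ^ β j) * sumYoungFactor ω s β)) := by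
  choose s₀ C _ hC h using fun j =>
    (hω j).exists_exp_le_exp_neg_mul_pow_mul_youngFactor hr
  obtain ⟨s, hs⟩ := Finite.exists_le s₀
  have hpos : 0 < max 1 s := by positivity
  refine ⟨max 1 s, ∏ j, C j, hpos, Finset.prod_pos fun j _ => hC j, fun x => ?_⟩
  choose β hβ using fun j => h j _ ((hs j).trans (le_max_right 1 s)) |x j| (abs_nonneg _)
  refine ⟨β, ?_⟩
  rw [sumYoungFactor_eq_prod ω hpos, ← Finset.prod_mul_distrib, ← Finset.prod_mul_distrib,
    ← Finset.prod_mul_distrib, sumWeight, Finset.mul_sum, Real.exp_sum]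
  exact Finset.prod_le_prod (fun j _ => (Real.exp_pos _).le) fun j _ => hβ j

lemma exists_sumYoungFactor_pos (hω : ∀ j, IsWeightFunction (ω j)) (β : Fin N → ℕ) :
    ∃ r : ℝ, 0 < r ∧ 0 < sumYoungFactor ω r β := by
  choose R _ h using fun j => (hω j).exists_youngFactor_pos (β j)
  obtain ⟨R', hR'⟩ := Finite.exists_le R
  have hpos : 0 < max 1 R' := by positivity
  refine ⟨max 1 R', hpos, ?_⟩
  rw [sumYoungFactor_eq_prod ω hpos]
  exact Finset.prod_pos fun j _ => h j _ ((hR' j).trans (le_max_right _ _))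

end SumWeight

section GaussianWindow

open FourierTransform

/-- `f` multiplied by the Gaussian window centred at `x`; its Fourier transform at `ξ` is the
short-time Fourier transform of `f` at `(x, ξ)`. -/
noncomputable def gaussianWindow {V : Type*} [NormedAddCommGroup V] (f : V → ℂ) (x y : V) : ℂ :=
  (Real.exp (-(Real.pi * ‖x - y‖ ^ 2)) : ℂ) * f y

lemma norm_gaussianWindow {V : Type*} [NormedAddCommGroup V] (f : V → ℂ) (x y : V) :
    ‖gaussianWindow f x y‖ = ‖f y‖ * Real.exp (-(Real.pi * ‖x - y‖ ^ 2)) := by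
  rw [gaussianWindow, norm_mul, Complex.norm_real, Real.norm_of_nonneg (Real.exp_pos _).le,
    mul_comm]

variable {V : Type*} [NormedAddCommGroup V] [InnerProductSpace ℝ V] [FiniteDimensional ℝ V]
  [MeasurableSpace V] [BorelSpace V] {Ω : V → ℝ}

lemma integrable_exp_mul_norm_mul_gaussian (B : ℝ) :
    Integrable fun s : V => Real.exp (B * ‖s‖) * Real.exp (-(Real.pi * ‖s‖ ^ 2)) := by
  have hgauss := GaussianFourier.integrable_cexp_neg_mul_sq_norm_add (V := V) (b := 1)
    (by simp) 0 0
  refine (hgauss.norm.const_mul (Real.exp (B ^ 2 / 2))).mono' (by fun_prop)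
    (ae_of_all _ fun s => ?_)
  rw [Real.norm_of_nonneg (by positivity), Complex.norm_exp, ← Real.exp_add, ← Real.exp_add]
  simp only [zero_mul, add_zero, neg_mul, one_mul, Complex.neg_re, ← Complex.ofReal_pow,
    Complex.ofReal_re]
  apply Real.exp_le_exp.2
  nlinarith [sq_nonneg (B - ‖s‖), Real.pi_gt_three, sq_nonneg ‖s‖]

lemma IsModerateWeight.integrable_exp_mul_gaussian (hΩ : IsModerateWeight Ω) {r : ℝ}
    (hr : 0 ≤ r) :
    Integrable fun s => Real.exp (r * Ω s) * Real.exp (-(Real.pi * ‖s‖ ^ 2)) := by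
  obtain ⟨A, _, hlin⟩ := hΩ.le_linear
  have hcont := hΩ.continuous
  refine ((integrable_exp_mul_norm_mul_gaussian (r * A)).const_mul (Real.exp (r * A))).mono'
    (by fun_prop) (ae_of_all _ fun s => ?_)
  rw [Real.norm_of_nonneg (by positivity), ← mul_assoc, ← Real.exp_add (r * A)]
  gcongr
  calc r * Ω s ≤ r * (A * (1 + ‖s‖)) := by gcongr; exact hlin s
    _ = _ := by ring

lemma RapidDecay.integral_norm_mul_gaussian_le {F : Type*} [NormedAddCommGroup F]
    (hΩ : IsModerateWeight Ω) {g : V → F} (hg : RapidDecay Ω g) {r : ℝ} (hr : 0 < r) :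
    ∃ C : ℝ, 0 < C ∧ ∀ x, ∫ y, ‖g y‖ * Real.exp (-(Real.pi * ‖x - y‖ ^ 2)) ≤
      C * Real.exp (-(r * Ω x)) := by
  obtain ⟨K, hK, hadd⟩ := hΩ.add_le
  obtain ⟨C, hC, hgC⟩ := hg (r * K) (by positivity)
  have hint := hΩ.integrable_exp_mul_gaussian (r := r * K) (by positivity)
  set w : V → ℝ := fun s => Real.exp (r * K * Ω s) * Real.exp (-(Real.pi * ‖s‖ ^ 2)) with hw
  have : 0 ≤ ∫ s, w s := integral_nonneg fun s => by positivity
  have hbound : ∀ x y, ‖g y‖ * Real.exp (-(Real.pi * ‖x - y‖ ^ 2)) ≤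
      C * Real.exp (r * K) * Real.exp (-(r * Ω x)) * w (x - y) := by
    intro x y
    rw [hw, ← mul_assoc]
    gcongr
    refine (hgC y).trans ?_
    rw [mul_assoc C, mul_assoc C, ← Real.exp_add, ← Real.exp_add]
    gcongr
    have h := mul_le_mul_of_nonneg_left (hadd y (x - y)) hr.le
    rw [add_sub_cancel] at h
    linarith
  refine ⟨C * Real.exp (r * K) * (1 + ∫ s, w s), by positivity, fun x => ?_⟩
  calc _ ≤ ∫ y, C * Real.exp (r * K) * Real.exp (-(r * Ω x)) * w (x - y) :=
        integral_mono_of_nonneg (ae_of_all _ fun y => by positivity)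
          ((hint.comp_sub_left x).const_mul _) (ae_of_all _ (hbound x))
    _ = C * Real.exp (r * K) * (∫ s, w s) * Real.exp (-(r * Ω x)) := by
        rw [integral_const_mul, integral_sub_left_eq_self w]
        ring
    _ ≤ _ := by gcongr; linarith

lemma RapidDecay.integrable_pow_mul_norm {F : Type*} [NormedAddCommGroup F]
    (hΩ : IsModerateWeight Ω) {g : V → F} (hcont : Continuous g) (hg : RapidDecay Ω g) (n : ℕ) :
    Integrable fun x => (1 + ‖x‖) ^ n * ‖g x‖ := by
  obtain ⟨B, b, hB, hb, hexp⟩ := hΩ.one_add_norm_le_exp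
  obtain ⟨c, hc, hint⟩ := hΩ.exists_integrable_exp_neg volume
  obtain ⟨C, _, hgC⟩ := hg.exp_mul_norm_le (r := n * b) (c := c) (by positivity)
  refine (hint.const_mul (B ^ n * C)).mono' (by fun_prop) (ae_of_all _ fun x => ?_)
  rw [Real.norm_of_nonneg (by positivity)]
  calc (1 + ‖x‖) ^ n * ‖g x‖ ≤ (B * Real.exp (b * Ω x)) ^ n * ‖g x‖ := by gcongr; exact hexp x
    _ = B ^ n * (Real.exp (n * b * Ω x) * ‖g x‖) := by
        rw [mul_pow, ← Real.exp_nat_mul, mul_assoc (n : ℝ), mul_assoc]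
    _ ≤ B ^ n * (C * Real.exp (-(c * Ω x))) := by gcongr ?_ * ?_; exact hgC x
    _ = _ := by ring

lemma integrable_gaussianWindow {f : V → ℂ} (hf : Integrable f) (x : V) :
    Integrable (gaussianWindow f x) := by
  have hmeas : AEStronglyMeasurable (fun y : V => (Real.exp (-(Real.pi * ‖x - y‖ ^ 2)) : ℂ)) :=
    Continuous.aestronglyMeasurable (by fun_prop)
  refine hf.norm.mono' (hmeas.mul hf.1) (ae_of_all _ fun y => ?_)
  rw [norm_gaussianWindow]
  exact mul_le_of_le_one_right (norm_nonneg _)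
    (Real.exp_le_one_iff.2 (neg_nonpos.2 (by positivity)))

lemma continuous_fourier_gaussianWindow {f : V → ℂ} (hf : Integrable f) (x : V) :
    Continuous (𝓕 (gaussianWindow f x)) :=
  VectorFourier.fourierIntegral_continuous (L := innerₗ V) Real.continuous_fourierChar
    continuous_inner (integrable_gaussianWindow hf x)

lemma norm_fourier_gaussianWindow_le (f : V → ℂ) (x ξ : V) :
    ‖𝓕 (gaussianWindow f x) ξ‖ ≤ ∫ y, ‖f y‖ * Real.exp (-(Real.pi * ‖x - y‖ ^ 2)) := by
  simp_rw [← norm_gaussianWindow]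
  exact VectorFourier.norm_fourierIntegral_le_integral_norm _ _ _ _ _

lemma fourier_modulated_gaussian (x y : V) :
    𝓕 (fun v : V => Complex.exp (-Real.pi * ‖v‖ ^ 2 + 2 * Real.pi * Complex.I * inner ℝ x v)) y =
      Real.exp (-(Real.pi * ‖x - y‖ ^ 2)) := by
  have hpi : (Real.pi : ℂ) ≠ 0 := by exact_mod_cast Real.pi_ne_zero
  rw [fourier_gaussian_innerProductSpace' (by simpa using Real.pi_pos), div_self hpi,
    Complex.one_cpow, one_mul, Complex.ofReal_exp]
  push_cast
  field_simp

-- The window at `x`, modulated by `ξ`, is itself the Fourier transform of a Gaussian centred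
-- at `ξ`; the Fourier transform is moved from that Gaussian to `f`.
lemma norm_fourier_gaussianWindow_le_fourier {f : V → ℂ} (hf : Integrable f) (x ξ : V) :
    ‖𝓕 (gaussianWindow f x) ξ‖ ≤ ∫ v, ‖𝓕 f v‖ * Real.exp (-(Real.pi * ‖ξ - v‖ ^ 2)) := by
  set k : V → ℂ := fun v =>
    Complex.exp (-Real.pi * ‖v‖ ^ 2 + 2 * Real.pi * Complex.I * inner ℝ x v)
  have hk : Integrable k :=
    GaussianFourier.integrable_cexp_neg_mul_sq_norm_add (by simpa using Real.pi_pos) _ _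
  have norm_k : ∀ v, ‖k v‖ = Real.exp (-(Real.pi * ‖v‖ ^ 2)) := fun v => by
    simp [k, Complex.norm_exp, ← Complex.ofReal_pow]
  have fourier_k_sub : ∀ y, 𝓕 (fun v => k (v - ξ)) y =
      Real.fourierChar (-inner ℝ y ξ) • (Real.exp (-(Real.pi * ‖x - y‖ ^ 2)) : ℂ) := fun y => by
    rw [← fourier_modulated_gaussian, ← real_inner_comm, ← inner_neg_left]
    simp only [sub_eq_add_neg]
    exact congrFun (VectorFourier.fourierIntegral_comp_add_right Real.fourierChar volume
      (innerₗ V) k (-ξ)) y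
  calc ‖𝓕 (gaussianWindow f x) ξ‖ = ‖∫ y, f y • 𝓕 (fun v => k (v - ξ)) y‖ := by
        rw [Real.fourier_eq]
        congr 2 with y
        simp only [fourier_k_sub, gaussianWindow, Circle.smul_def, smul_eq_mul]
        ring
    _ = ‖∫ v, 𝓕 f v • k (v - ξ)‖ := by
        congr 1
        simpa using! (VectorFourier.integral_fourierIntegral_smul_eq_flip (L := innerₗ V)
          Real.continuous_fourierChar continuous_inner hf (hk.comp_sub_right ξ)).symm
    _ ≤ ∫ v, ‖𝓕 f v • k (v - ξ)‖ := norm_integral_le_integral_norm _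
    _ = _ := by simp only [norm_smul, norm_k, norm_sub_rev ξ]

lemma exists_norm_fourier_gaussianWindow_le {Θ : V → ℝ} (hΩ : IsModerateWeight Ω)
    (hΘ : IsModerateWeight Θ) {f : V → ℂ} (hf : Integrable f) (hfΩ : RapidDecay Ω f)
    (hfΘ : RapidDecay Θ (𝓕 f)) {r s : ℝ} (hr : 0 < r) (hs : 0 < s) :
    ∃ C : ℝ, 0 < C ∧ ∀ x ξ, ‖𝓕 (gaussianWindow f x) ξ‖ ≤
      C * (Real.exp (-(r * Ω x)) * Real.exp (-(s * Θ ξ))) := by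
  obtain ⟨C, hC, hfC⟩ := hfΩ.integral_norm_mul_gaussian_le hΩ (r := 2 * r) (by positivity)
  obtain ⟨D, hD, hfD⟩ := hfΘ.integral_norm_mul_gaussian_le hΘ (r := 2 * s) (by positivity)
  refine ⟨√(C * D), by positivity, fun x ξ => ?_⟩
  have exp_two_mul : ∀ a b : ℝ, Real.exp (-(2 * a * b)) = Real.exp (-(a * b)) ^ 2 := fun a b => by
    rw [← Real.exp_nat_mul]
    push_cast
    ring_nf
  have hx := (norm_fourier_gaussianWindow_le f x ξ).trans (hfC x)
  have hξ := (norm_fourier_gaussianWindow_le_fourier hf x ξ).trans (hfD ξ)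
  rw [exp_two_mul] at hx hξ
  refine le_of_sq_le_sq ?_ (by positivity)
  calc ‖𝓕 (gaussianWindow f x) ξ‖ ^ 2
      = ‖𝓕 (gaussianWindow f x) ξ‖ * ‖𝓕 (gaussianWindow f x) ξ‖ := sq _
    _ ≤ (C * Real.exp (-(r * Ω x)) ^ 2) * (D * Real.exp (-(s * Θ ξ)) ^ 2) := by gcongr
    _ = (√(C * D) * (Real.exp (-(r * Ω x)) * Real.exp (-(s * Θ ξ)))) ^ 2 := by
        rw [mul_pow, Real.sq_sqrt (by positivity)]
        ring

end GaussianWindow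

section Superposition

open LineDeriv

/-- The exponent `2πi⟨ξ, y⟩ + 2π⟨s, y⟩` at `θ = (ξ, s)`, that of a plane wave with complex
frequency. -/
noncomputable def expPhase {E : Type*} [NormedAddCommGroup E] [InnerProductSpace ℝ E]
    (θ : E × E) (y : E) : ℂ :=
  2 * Real.pi * Complex.I * (inner ℝ θ.1 y : ℝ) + 2 * Real.pi * (inner ℝ θ.2 y : ℝ)

/-- `h` is integrable against every `(1 + ‖ξ‖) ^ n * exp (n * ‖s‖)`, so that the superposition
`y ↦ ∫ h θ * exp (expPhase θ y)` of exponentials may be differentiated under the integral sign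
arbitrarily often. -/
def ExpIntegrable {E : Type*} [NormedAddCommGroup E] [MeasurableSpace E] (ν : Measure (E × E))
    (h : E × E → ℂ) : Prop :=
  AEStronglyMeasurable h ν ∧
    ∀ n : ℕ, Integrable (fun θ => ‖h θ‖ * ((1 + ‖θ.1‖) ^ n * Real.exp (n * ‖θ.2‖))) ν

variable {E : Type*} [NormedAddCommGroup E] [InnerProductSpace ℝ E]

lemma re_expPhase (θ : E × E) (y : E) : (expPhase θ y).re = 2 * Real.pi * inner ℝ θ.2 y := by
  simp [expPhase]

lemma norm_expPhase_le (θ : E × E) (y : E) :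
    ‖expPhase θ y‖ ≤ 2 * Real.pi * (|inner ℝ θ.1 y| + |inner ℝ θ.2 y|) := by
  refine (norm_add_le _ _).trans_eq ?_
  simp [abs_of_pos Real.pi_pos]
  ring

lemma norm_expPhase_le_mul_exp (θ : E × E) (y : E) :
    ‖expPhase θ y‖ ≤ 2 * Real.pi * ‖y‖ * ((1 + ‖θ.1‖) * Real.exp ‖θ.2‖) :=
  calc ‖expPhase θ y‖ ≤ 2 * Real.pi * (|inner ℝ θ.1 y| + |inner ℝ θ.2 y|) := norm_expPhase_le θ y
    _ ≤ 2 * Real.pi * (‖θ.1‖ * ‖y‖ + ‖θ.2‖ * ‖y‖) := by gcongr <;> exact abs_real_inner_le_norm _ _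
    _ = 2 * Real.pi * ‖y‖ * (‖θ.1‖ + ‖θ.2‖) := by ring
    _ ≤ 2 * Real.pi * ‖y‖ * ((1 + ‖θ.1‖) * Real.exp ‖θ.2‖) := by
        gcongr
        nlinarith [Real.add_one_le_exp ‖θ.2‖, norm_nonneg θ.1, norm_nonneg θ.2,
          mul_nonneg (norm_nonneg θ.1) (norm_nonneg θ.2)]

lemma continuous_expPhase (y : E) : Continuous fun θ : E × E => expPhase θ y := by
  unfold expPhase
  fun_prop

lemma hasDerivAt_expPhase_add_smul (θ : E × E) (y v : E) (t : ℝ) :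
    HasDerivAt (fun t : ℝ => expPhase θ (y + t • v)) (expPhase θ v) t := by
  have affine : ∀ t : ℝ, expPhase θ (y + t • v) = expPhase θ y + t * expPhase θ v := fun t => by
    simp only [expPhase, inner_add_right, inner_smul_right]
    push_cast
    ring
  simp_rw [affine]
  simpa using ((Complex.ofRealCLM.hasDerivAt (x := t)).mul_const
    (expPhase θ v)).const_add (expPhase θ y)

lemma norm_cexp_expPhase_le (θ : E × E) {y : E} {n : ℕ} (hn : 2 * Real.pi * ‖y‖ ≤ n) :
    ‖Complex.exp (expPhase θ y)‖ ≤ (1 + ‖θ.1‖) ^ n * Real.exp (n * ‖θ.2‖) := by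
  rw [Complex.norm_exp, re_expPhase]
  calc Real.exp (2 * Real.pi * inner ℝ θ.2 y) ≤ Real.exp (2 * Real.pi * (‖θ.2‖ * ‖y‖)) := by
        gcongr
        exact real_inner_le_norm _ _
    _ ≤ Real.exp (n * ‖θ.2‖) := by
        rw [mul_left_comm, mul_comm (n : ℝ)]
        gcongr
    _ ≤ _ := le_mul_of_one_le_left (Real.exp_pos _).le
        (one_le_pow₀ (le_add_of_nonneg_right (norm_nonneg _)))

namespace ExpIntegrable

variable [MeasurableSpace E] [BorelSpace E] [SecondCountableTopology E] {ν : Measure (E × E)}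
  {h : E × E → ℂ}

lemma mul_expPhase (hh : ExpIntegrable ν h) (v : E) :
    ExpIntegrable ν fun θ => expPhase θ v * h θ := by
  have hmeas := (continuous_expPhase v).aestronglyMeasurable.mul hh.1
  have hweight : ∀ n : ℕ, AEStronglyMeasurable
      (fun θ : E × E => (1 + ‖θ.1‖) ^ n * Real.exp (n * ‖θ.2‖)) ν := fun n =>
    Continuous.aestronglyMeasurable (by fun_prop)
  refine ⟨hmeas, fun n => ((hh.2 (n + 1)).const_mul (2 * Real.pi * ‖v‖)).mono'
    (hmeas.norm.mul (hweight n)) (ae_of_all _ fun θ => ?_)⟩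
  rw [Real.norm_of_nonneg (by positivity), norm_mul]
  calc _ ≤ (2 * Real.pi * ‖v‖ * ((1 + ‖θ.1‖) * Real.exp ‖θ.2‖)) * ‖h θ‖ *
        ((1 + ‖θ.1‖) ^ n * Real.exp (n * ‖θ.2‖)) := by
        gcongr
        exact norm_expPhase_le_mul_exp θ v
    _ = _ := by
        push_cast
        rw [add_mul (n : ℝ), one_mul, Real.exp_add]
        ring

lemma hasLineDerivAt (hh : ExpIntegrable ν h) (y v : E) :
    HasLineDerivAt ℝ (fun y => ∫ θ, h θ * Complex.exp (expPhase θ y) ∂ν)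
      (∫ θ, (expPhase θ v * h θ) * Complex.exp (expPhase θ y) ∂ν) y v := by
  obtain ⟨n, hn⟩ := exists_nat_ge (2 * Real.pi * (‖y‖ + ‖v‖))
  have hexp : ∀ t ∈ Metric.ball (0 : ℝ) 1, ∀ θ : E × E,
      ‖Complex.exp (expPhase θ (y + t • v))‖ ≤ (1 + ‖θ.1‖) ^ n * Real.exp (n * ‖θ.2‖) := by
    intro t ht θ
    refine norm_cexp_expPhase_le θ (le_trans ?_ hn)
    gcongr
    refine norm_add_le_of_le le_rfl ?_
    rw [norm_smul]
    exact mul_le_of_le_one_left (norm_nonneg _) (mem_ball_zero_iff.1 ht).le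
  have hmeas : ∀ g : E × E → ℂ, AEStronglyMeasurable g ν → ∀ z : E,
      AEStronglyMeasurable (fun θ => g θ * Complex.exp (expPhase θ z)) ν := fun g hg z =>
    hg.mul (Complex.continuous_exp.comp (continuous_expPhase z)).aestronglyMeasurable
  have bound : ∀ g : E × E → ℂ, ∀ θ, ∀ t ∈ Metric.ball (0 : ℝ) 1,
      ‖g θ * Complex.exp (expPhase θ (y + t • v))‖ ≤
        ‖g θ‖ * ((1 + ‖θ.1‖) ^ n * Real.exp (n * ‖θ.2‖)) := fun g θ t ht => by
    rw [norm_mul]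
    gcongr
    exact hexp t ht θ
  have hv := hh.mul_expPhase v
  have hderiv := (hasDerivAt_integral_of_dominated_loc_of_deriv_le (μ := ν) (x₀ := (0 : ℝ))
    (Metric.ball_mem_nhds 0 one_pos) (Eventually.of_forall fun t => hmeas h hh.1 (y + t • v))
    ((hh.2 n).mono' (hmeas h hh.1 _)
      (ae_of_all _ fun θ => bound h θ 0 (Metric.mem_ball_self one_pos)))
    (hmeas _ hv.1 _) (ae_of_all _ fun θ => bound (fun θ => expPhase θ v * h θ) θ) (hv.2 n)
    (ae_of_all _ fun θ t _ => (((hasDerivAt_expPhase_add_smul θ y v t).cexp).const_mul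
      (h θ)).congr_deriv (by ring))).2
  simpa only [HasLineDerivAt, zero_smul, add_zero] using hderiv

lemma prod_mul_expPhase (hh : ExpIntegrable ν h) {n : ℕ} (m : Fin n → E) :
    ExpIntegrable ν fun θ => (∏ i, expPhase θ (m i)) * h θ := by
  induction n with
  | zero => simpa using hh
  | succ n ih =>
    simpa only [Fin.prod_univ_succ, mul_assoc] using!
      (ih (Fin.tail m)).mul_expPhase (m 0)

lemma iteratedLineDerivOp_eq {f : 𝓢(E, ℂ)} (hh : ExpIntegrable ν h)
    (hf : ∀ y, f y = ∫ θ, h θ * Complex.exp (expPhase θ y) ∂ν) {n : ℕ} (m : Fin n → E) (y : E) :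
    (∂^{m} f : 𝓢(E, ℂ)) y =
      ∫ θ, ((∏ i, expPhase θ (m i)) * h θ) * Complex.exp (expPhase θ y) ∂ν := by
  induction n generalizing y with
  | zero => simpa using hf y
  | succ n ih =>
    have hderiv := (hh.prod_mul_expPhase (Fin.tail m)).hasLineDerivAt y (m 0)
    simp_rw [← ih (Fin.tail m)] at hderiv
    simpa only [iteratedLineDerivOp_succ_left, SchwartzMap.lineDerivOp_apply, Fin.prod_univ_succ,
      mul_assoc] using! hderiv.lineDeriv

end ExpIntegrable

end Superposition

section WindowDensity

open FourierTransform LineDeriv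

variable {V : Type*} [NormedAddCommGroup V] [InnerProductSpace ℝ V] [FiniteDimensional ℝ V]
  [MeasurableSpace V] [BorelSpace V] {Ω Θ : V → ℝ}

/-- The density, for each centre `x`, representing `f` as a superposition of the exponentials
`exp (expPhase θ y)`. It comes from dividing the Fourier inversion formula of the window
`gaussianWindow f x` by the Gaussian, whose inverse is again a superposition of exponentials. -/
noncomputable def windowDensity (f : V → ℂ) (x : V) (θ : V × V) : ℂ :=
  𝓕 (gaussianWindow f x) θ.1 *
    (Real.exp (-(Real.pi * ‖θ.2‖ ^ 2) - 2 * Real.pi * inner ℝ x θ.2) : ℂ)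

lemma norm_windowDensity_mul_cexp (f : V → ℂ) (x : V) (θ : V × V) :
    ‖windowDensity f x θ * Complex.exp (expPhase θ x)‖ =
      ‖𝓕 (gaussianWindow f x) θ.1‖ * Real.exp (-(Real.pi * ‖θ.2‖ ^ 2)) := by
  rw [windowDensity, norm_mul, norm_mul, Complex.norm_real,
    Real.norm_of_nonneg (Real.exp_pos _).le, Complex.norm_exp, re_expPhase, mul_assoc,
    ← Real.exp_add, real_inner_comm x θ.2, sub_add_cancel]

lemma rapidDecay_fourier_gaussianWindow (hΘ : IsModerateWeight Θ) {f : V → ℂ}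
    (hf : Integrable f) (hfΘ : RapidDecay Θ (𝓕 f)) (x : V) :
    RapidDecay Θ (𝓕 (gaussianWindow f x)) := fun _ hr =>
  (hfΘ.integral_norm_mul_gaussian_le hΘ hr).imp fun _ hC =>
    ⟨hC.1, fun ξ => (norm_fourier_gaussianWindow_le_fourier hf x ξ).trans (hC.2 ξ)⟩

lemma expIntegrable_windowDensity (hΘ : IsModerateWeight Θ) {f : V → ℂ} (hf : Integrable f)
    (hfΘ : RapidDecay Θ (𝓕 f)) (x : V) : ExpIntegrable volume (windowDensity f x) := by
  have hcont := continuous_fourier_gaussianWindow hf x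
  refine ⟨Continuous.aestronglyMeasurable (by unfold windowDensity; fun_prop), fun n => ?_⟩
  have hgauss : Integrable fun s : V =>
      Real.exp (-(Real.pi * ‖s‖ ^ 2) - 2 * Real.pi * inner ℝ x s) * Real.exp (n * ‖s‖) := by
    refine (integrable_exp_mul_norm_mul_gaussian (n + 2 * Real.pi * ‖x‖)).mono' (by fun_prop)
      (ae_of_all _ fun s => ?_)
    rw [Real.norm_of_nonneg (by positivity), ← Real.exp_add, ← Real.exp_add]
    apply Real.exp_le_exp.2
    nlinarith [neg_le_of_abs_le (abs_real_inner_le_norm x s), Real.pi_pos]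
  refine (((rapidDecay_fourier_gaussianWindow hΘ hf hfΘ x).integrable_pow_mul_norm hΘ hcont
    n).mul_prod hgauss).congr (ae_of_all _ fun θ => ?_)
  simp only [windowDensity, norm_mul, Complex.norm_real, Real.norm_of_nonneg (Real.exp_pos _).le]
  ring

lemma windowDensity_mul_cexp (f : V → ℂ) (x y : V) (θ : V × V) :
    windowDensity f x θ * Complex.exp (expPhase θ y) =
      (Complex.exp (((2 * Real.pi * inner ℝ θ.1 y : ℝ) : ℂ) * Complex.I) •
        𝓕 (gaussianWindow f x) θ.1) *
      Complex.exp (-Real.pi * ‖θ.2‖ ^ 2 + 2 * Real.pi * (inner ℝ (y - x) θ.2 : ℝ)) := by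
  have exponent : ((-(Real.pi * ‖θ.2‖ ^ 2) - 2 * Real.pi * inner ℝ x θ.2 : ℝ) : ℂ) +
      expPhase θ y = ((2 * Real.pi * inner ℝ θ.1 y : ℝ) : ℂ) * Complex.I +
        (-Real.pi * ‖θ.2‖ ^ 2 + 2 * Real.pi * (inner ℝ (y - x) θ.2 : ℝ)) := by
    rw [expPhase, inner_sub_left, real_inner_comm y θ.2]
    push_cast
    ring
  rw [windowDensity, smul_eq_mul, Complex.ofReal_exp, mul_assoc, ← Complex.exp_add, exponent,
    Complex.exp_add]
  ring

lemma eq_integral_windowDensity {f : V → ℂ} (hf : Integrable f) (hfc : Continuous f) {x : V}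
    (hV : Integrable (𝓕 (gaussianWindow f x))) (y : V) :
    f y = ∫ θ, windowDensity f x θ * Complex.exp (expPhase θ y) := by
  have hpi : (Real.pi : ℂ) ≠ 0 := by exact_mod_cast Real.pi_ne_zero
  have inversion := congrFun (Continuous.fourierInv_fourier_eq (f := gaussianWindow f x)
    (by unfold gaussianWindow; fun_prop) (integrable_gaussianWindow hf x) hV) y
  have gaussian := GaussianFourier.integral_cexp_neg_mul_sq_norm_add (b := (Real.pi : ℂ))
    (by simpa using Real.pi_pos) (2 * Real.pi) (y - x)
  rw [Real.fourierInv_eq'] at inversion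
  rw [div_self hpi, Complex.one_cpow, one_mul] at gaussian
  have cancel : (((-(Real.pi * ‖y - x‖ ^ 2) : ℝ) : ℂ) +
      (2 * (Real.pi : ℂ)) ^ 2 * (‖y - x‖ : ℂ) ^ 2 / (4 * Real.pi)) = 0 := by
    push_cast
    field_simp
    ring
  simp_rw [windowDensity_mul_cexp]
  rw [Measure.volume_eq_prod, integral_prod_mul (fun ξ => Complex.exp
      (((2 * Real.pi * inner ℝ ξ y : ℝ) : ℂ) * Complex.I) • 𝓕 (gaussianWindow f x) ξ)
      (fun s => Complex.exp (-Real.pi * ‖s‖ ^ 2 + 2 * Real.pi * (inner ℝ (y - x) s : ℝ))),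
    inversion, gaussian, gaussianWindow, Complex.ofReal_exp, mul_right_comm, ← Complex.exp_add,
    norm_sub_rev, cancel, Complex.exp_zero, one_mul]

lemma iteratedLineDerivOp_eq_integral_windowDensity (hΘ : IsModerateWeight Θ) {f : 𝓢(V, ℂ)}
    (hfΘ : RapidDecay Θ (𝓕 (f : V → ℂ))) {n : ℕ} (m : Fin n → V) (x : V) :
    (∂^{m} f : 𝓢(V, ℂ)) x = ∫ θ : V × V, (∏ i, expPhase θ (m i)) *
      (windowDensity f x θ * Complex.exp (expPhase θ x)) := by
  have hcont := continuous_fourier_gaussianWindow f.integrable x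
  have hV : Integrable (𝓕 (gaussianWindow f x)) := by
    refine (integrable_norm_iff hcont.aestronglyMeasurable).1 ?_
    simpa using (rapidDecay_fourier_gaussianWindow hΘ f.integrable hfΘ x).integrable_pow_mul_norm
      hΘ hcont 0
  simpa only [mul_assoc] using
    (expIntegrable_windowDensity hΘ f.integrable hfΘ x).iteratedLineDerivOp_eq
      (eq_integral_windowDensity f.integrable f.continuous hV) m x

-- Here `κ` plays the role of a Young factor, which compensates the growth of the exponents.
lemma exists_mul_norm_prod_mul_windowDensity_le (hΩ : IsModerateWeight Ω)
    (hΘ : IsModerateWeight Θ) {f : V → ℂ} (hf : Integrable f) (hfΩ : RapidDecay Ω f)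
    (hfΘ : RapidDecay Θ (𝓕 f)) {r t : ℝ} (hr : 0 ≤ r) (ht : 0 < t) :
    ∃ w : V × V → ℝ, Integrable w ∧ (∀ θ, 0 ≤ w θ) ∧
      ∀ (n : ℕ) (m : Fin n → V) (κ : ℝ) (θ : V × V), 0 ≤ κ →
        κ * ∏ i, ‖expPhase θ (m i)‖ ≤ Real.exp (r * (Θ θ.1 + Θ θ.2)) →
        ∀ x, κ * ‖(∏ i, expPhase θ (m i)) * (windowDensity f x θ * Complex.exp (expPhase θ x))‖ ≤
          Real.exp (-(t * Ω x)) * w θ := by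
  obtain ⟨c, hc, hint⟩ := hΘ.exists_integrable_exp_neg volume
  obtain ⟨C, hC, hVC⟩ := exists_norm_fourier_gaussianWindow_le hΩ hΘ hf hfΩ hfΘ
    (r := t) (s := r + c) ht (by positivity)
  refine ⟨fun θ => C * (Real.exp (-(c * Θ θ.1)) *
    (Real.exp (r * Θ θ.2) * Real.exp (-(Real.pi * ‖θ.2‖ ^ 2)))),
    (hint.mul_prod (hΘ.integrable_exp_mul_gaussian hr)).const_mul C, fun θ => by positivity,
    fun n m κ θ _ hm x => ?_⟩
  rw [norm_mul, norm_prod, norm_windowDensity_mul_cexp, ← mul_assoc κ]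
  calc _ ≤ Real.exp (r * (Θ θ.1 + Θ θ.2)) * (C * (Real.exp (-(t * Ω x)) *
        Real.exp (-((r + c) * Θ θ.1))) * Real.exp (-(Real.pi * ‖θ.2‖ ^ 2))) := by
        gcongr
        exact hVC x θ.1
    _ = Real.exp (-(t * Ω x)) * (C * (Real.exp (r * (Θ θ.1 + Θ θ.2)) *
        Real.exp (-((r + c) * Θ θ.1)) * Real.exp (-(Real.pi * ‖θ.2‖ ^ 2)))) := by ring
    _ = _ := by
        simp only [← Real.exp_add]
        ring_nf

lemma exists_mul_norm_iteratedLineDerivOp_le (hΩ : IsModerateWeight Ω) (hΘ : IsModerateWeight Θ)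
    (f : 𝓢(V, ℂ)) (hfΩ : RapidDecay Ω f) (hfΘ : RapidDecay Θ (𝓕 (f : V → ℂ))) {r t : ℝ}
    (hr : 0 ≤ r) (ht : 0 < t) :
    ∃ C : ℝ, 0 < C ∧ ∀ (n : ℕ) (m : Fin n → V) (κ : ℝ), 0 ≤ κ →
      (∀ θ : V × V, κ * ∏ i, ‖expPhase θ (m i)‖ ≤ Real.exp (r * (Θ θ.1 + Θ θ.2))) →
      ∀ x, κ * ‖(∂^{m} f : 𝓢(V, ℂ)) x‖ ≤ C * Real.exp (-(t * Ω x)) := by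
  obtain ⟨w, hwint, hw, hbound⟩ :=
    exists_mul_norm_prod_mul_windowDensity_le hΩ hΘ f.integrable hfΩ hfΘ hr ht
  have hw0 : 0 ≤ ∫ θ, w θ := integral_nonneg hw
  refine ⟨1 + ∫ θ, w θ, by positivity, fun n m κ hκ hm x => ?_⟩
  calc κ * ‖(∂^{m} f : 𝓢(V, ℂ)) x‖ = ‖∫ θ : V × V, κ • ((∏ i, expPhase θ (m i)) *
        (windowDensity f x θ * Complex.exp (expPhase θ x)))‖ := by
        rw [integral_smul, norm_smul, Real.norm_of_nonneg hκ,
          iteratedLineDerivOp_eq_integral_windowDensity hΘ hfΘ m x]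
    _ ≤ Real.exp (-(t * Ω x)) * ∫ θ, w θ := by
        rw [← integral_const_mul]
        refine norm_integral_le_of_norm_le (hwint.const_mul _) (ae_of_all _ fun θ => ?_)
        rw [norm_smul, Real.norm_of_nonneg hκ]
        exact hbound n m κ θ hκ (hm θ) x
    _ ≤ (1 + ∫ θ, w θ) * Real.exp (-(t * Ω x)) := by
        rw [mul_comm]
        gcongr
        linarith

end WindowDensity

section MultiDeriv

open FourierTransform LineDeriv

variable {N : ℕ} {ω σ : Fin N → ℝ → ℝ}

/-- The directions of differentiation in `multiDeriv α`: the standard basis vectors, the `j`-th one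
being repeated `α j` times. -/
noncomputable def multiDir (α : Fin N → ℕ) (i : Fin (∑ j, α j)) : EuclideanSpace ℝ (Fin N) :=
  EuclideanSpace.single (finSigmaFinEquiv.symm i).1 (1 : ℝ)

lemma prod_multiDir {M : Type*} [CommMonoid M] (α : Fin N → ℕ) (φ : Fin N → M) :
    ∏ i : Fin (∑ j, α j), φ (finSigmaFinEquiv.symm i).1 = ∏ j, φ j ^ α j := by
  rw [← Equiv.prod_comp finSigmaFinEquiv, Fintype.prod_sigma]
  simp

lemma multiDeriv_eq (α : Fin N → ℕ) (f : 𝓢(EuclideanSpace ℝ (Fin N), ℂ))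
    (x : EuclideanSpace ℝ (Fin N)) :
    multiDeriv α f x = (-Complex.I) ^ (∑ j, α j) *
      (∂^{multiDir α} f : 𝓢(EuclideanSpace ℝ (Fin N), ℂ)) x := by
  rw [SchwartzMap.iteratedLineDerivOp_eq_iteratedFDeriv]
  rfl

lemma norm_multiDeriv (α : Fin N → ℕ) (f : 𝓢(EuclideanSpace ℝ (Fin N), ℂ))
    (x : EuclideanSpace ℝ (Fin N)) :
    ‖multiDeriv α f x‖ = ‖(∂^{multiDir α} f : 𝓢(EuclideanSpace ℝ (Fin N), ℂ)) x‖ := by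
  simp [multiDeriv_eq]

lemma continuous_multiDeriv (α : Fin N → ℕ) (f : 𝓢(EuclideanSpace ℝ (Fin N), ℂ)) :
    Continuous (multiDeriv α f) := by
  simp_rw [funext (multiDeriv_eq α f)]
  fun_prop

lemma multiDeriv_zero (f : EuclideanSpace ℝ (Fin N) → ℂ) : multiDeriv 0 f = f := by
  ext x
  have order_zero : ∀ n : ℕ, n = 0 → ∀ m : Fin n → EuclideanSpace ℝ (Fin N),
      (-Complex.I) ^ n * iteratedFDeriv ℝ n f x m = f x := by
    rintro n rfl m
    simp
  exact order_zero _ (by simp) _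

lemma prod_norm_expPhase_multiDir_le (α : Fin N → ℕ)
    (θ : EuclideanSpace ℝ (Fin N) × EuclideanSpace ℝ (Fin N)) :
    ∏ i, ‖expPhase θ (multiDir α i)‖ ≤ ∏ j, |2 * Real.pi * (|θ.1 j| + |θ.2 j|)| ^ α j := by
  rw [← prod_multiDir α fun j => |2 * Real.pi * (|θ.1 j| + |θ.2 j|)|]
  refine Finset.prod_le_prod (fun i _ => norm_nonneg _) fun i _ => ?_
  refine (norm_expPhase_le θ _).trans ((le_abs_self _).trans_eq ?_)
  simp [multiDir, EuclideanSpace.inner_single_right]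

lemma exists_sumYoungFactor_mul_prod_norm_expPhase_le (hσ : ∀ j, IsWeightFunction (σ j)) {r : ℝ}
    (hr : 0 < r) : ∃ s C : ℝ, 0 ≤ s ∧ 0 < C ∧ ∀ (α : Fin N → ℕ)
      (θ : EuclideanSpace ℝ (Fin N) × EuclideanSpace ℝ (Fin N)),
        sumYoungFactor σ r α * ∏ i, ‖expPhase θ (multiDir α i)‖ ≤
          C * Real.exp (s * (sumWeight σ θ.1 + sumWeight σ θ.2)) := by
  have hmod := isModerateWeight_sumWeight hσ
  obtain ⟨B, hB, hBx⟩ := sumYoungFactor_mul_prod_le hσ hr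
  obtain ⟨K, hK, hadd⟩ := hmod.add_le
  obtain ⟨L, hL, hsmul⟩ := hmod.smul_le (2 * Real.pi)
  let abs_coord : EuclideanSpace ℝ (Fin N) → EuclideanSpace ℝ (Fin N) := fun x =>
    WithLp.toLp 2 fun j => |x j|
  have sumWeight_abs : ∀ x, sumWeight σ (abs_coord x) = sumWeight σ x := fun x => by
    simp [sumWeight, abs_coord]
  refine ⟨r * L * K, B * Real.exp (r * (L * (1 + K))), by positivity, by positivity,
    fun α θ => ?_⟩
  set u := (2 * Real.pi) • (abs_coord θ.1 + abs_coord θ.2)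
  have hu : sumWeight σ u ≤ L * (1 + K * (1 + sumWeight σ θ.1 + sumWeight σ θ.2)) := by
    refine (hsmul _).trans ?_
    gcongr
    simpa only [sumWeight_abs] using hadd (abs_coord θ.1) (abs_coord θ.2)
  calc sumYoungFactor σ r α * ∏ i, ‖expPhase θ (multiDir α i)‖
      ≤ sumYoungFactor σ r α * ∏ j, |u j| ^ α j := by
        gcongr
        · exact sumYoungFactor_nonneg σ r α
        · exact prod_norm_expPhase_multiDir_le α θ
    _ ≤ B * Real.exp (r * sumWeight σ u) := hBx α u
    _ ≤ B * Real.exp (r * (L * (1 + K * (1 + sumWeight σ θ.1 + sumWeight σ θ.2)))) := by gcongr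
    _ = _ := by
        rw [mul_assoc B, ← Real.exp_add]
        ring_nf

lemma exists_sumYoungFactor_mul_norm_multiDeriv_le (hω : ∀ j, IsWeightFunction (ω j))
    (hσ : ∀ j, IsWeightFunction (σ j)) {f : 𝓢(EuclideanSpace ℝ (Fin N), ℂ)}
    (hf : RapidDecay (sumWeight ω) f)
    (hf' : RapidDecay (sumWeight σ) (𝓕 (f : EuclideanSpace ℝ (Fin N) → ℂ))) {r t : ℝ}
    (hr : 0 < r) (ht : 0 < t) : ∃ C : ℝ, 0 < C ∧ ∀ (α : Fin N → ℕ) (x : EuclideanSpace ℝ (Fin N)),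
      sumYoungFactor σ r α * ‖multiDeriv α f x‖ ≤ C * Real.exp (-(t * sumWeight ω x)) := by
  obtain ⟨s, B, hs, hB, hphase⟩ := exists_sumYoungFactor_mul_prod_norm_expPhase_le hσ hr
  obtain ⟨C, hC, hderiv⟩ := exists_mul_norm_iteratedLineDerivOp_le
    (isModerateWeight_sumWeight hω) (isModerateWeight_sumWeight hσ) f hf hf' hs ht
  refine ⟨B * C, by positivity, fun α x => ?_⟩
  have h := hderiv _ (multiDir α) (B⁻¹ * sumYoungFactor σ r α)
    (mul_nonneg (inv_pos.2 hB).le (sumYoungFactor_nonneg σ r α))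
    (fun θ => by rw [mul_assoc, inv_mul_le_iff₀ hB]; exact hphase α θ) x
  rwa [mul_assoc, inv_mul_le_iff₀ hB, ← norm_multiDeriv, ← mul_assoc] at h

lemma RapidDecay.multiDeriv (hω : ∀ j, IsWeightFunction (ω j)) (hσ : ∀ j, IsWeightFunction (σ j))
    {f : 𝓢(EuclideanSpace ℝ (Fin N), ℂ)} (hf : RapidDecay (sumWeight ω) f)
    (hf' : RapidDecay (sumWeight σ) (𝓕 (f : EuclideanSpace ℝ (Fin N) → ℂ))) (α : Fin N → ℕ) :
    RapidDecay (sumWeight ω) (multiDeriv α f) := by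
  intro t ht
  obtain ⟨r, hr, hpos⟩ := exists_sumYoungFactor_pos hσ α
  obtain ⟨C, hC, hCx⟩ := exists_sumYoungFactor_mul_norm_multiDeriv_le hω hσ hf hf' hr ht
  refine ⟨C / sumYoungFactor σ r α, by positivity, fun x => ?_⟩
  rw [div_mul_eq_mul_div, le_div_iff₀' hpos]
  exact hCx α x

lemma norm_monomialFun (β : Fin N → ℕ) (x : EuclideanSpace ℝ (Fin N)) :
    ‖(monomialFun β x : ℂ)‖ = ∏ j, |x j| ^ β j := by
  simp [monomialFun]

lemma monomialFun_zero (x : EuclideanSpace ℝ (Fin N)) : monomialFun 0 x = 1 := by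
  simp [monomialFun]

lemma continuous_monomialFun (β : Fin N → ℕ) : Continuous (monomialFun β) := by
  unfold monomialFun
  fun_prop

lemma RapidDecay.monomialFun_mul (hω : ∀ j, IsWeightFunction (ω j))
    {g : EuclideanSpace ℝ (Fin N) → ℂ} (hg : RapidDecay (sumWeight ω) g) (β : Fin N → ℕ) :
    RapidDecay (sumWeight ω) fun x => (monomialFun β x : ℂ) * g x := by
  intro r hr
  obtain ⟨s, hs, hpos⟩ := exists_sumYoungFactor_pos hω β
  obtain ⟨B, hB, hBx⟩ := sumYoungFactor_mul_prod_le hω hs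
  obtain ⟨C, hC, hgC⟩ := hg.exp_mul_norm_le (r := s) (c := r) (by positivity)
  refine ⟨B * C / sumYoungFactor ω s β, by positivity, fun x => ?_⟩
  rw [div_mul_eq_mul_div, le_div_iff₀' hpos, norm_mul, norm_monomialFun]
  calc sumYoungFactor ω s β * ((∏ j, |x j| ^ β j) * ‖g x‖)
      = (sumYoungFactor ω s β * ∏ j, |x j| ^ β j) * ‖g x‖ := by ring
    _ ≤ (B * Real.exp (s * sumWeight ω x)) * ‖g x‖ :=
        mul_le_mul_of_nonneg_right (hBx β x) (norm_nonneg _)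
    _ = B * (Real.exp (s * sumWeight ω x) * ‖g x‖) := by ring
    _ ≤ B * (C * Real.exp (-(r * sumWeight ω x))) :=
        mul_le_mul_of_nonneg_left (hgC x) hB.le
    _ = _ := by ring

end MultiDeriv

section FourierHat

open FourierTransform LineDeriv

variable {N : ℕ} {σ : Fin N → ℝ → ℝ}

lemma fourierHat_eq (f : EuclideanSpace ℝ (Fin N) → ℂ) (ξ : EuclideanSpace ℝ (Fin N)) :
    fourierHat f ξ = 𝓕 f ((2 * Real.pi)⁻¹ • ξ) := by
  rw [fourierHat, Real.fourier_eq']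
  congr! 4 with x
  rw [inner_smul_right, neg_mul, neg_mul, neg_mul, mul_inv_cancel_left₀ (by positivity)]
  push_cast
  ring

lemma exists_schwartzMap_eq_fourierHat (f : 𝓢(EuclideanSpace ℝ (Fin N), ℂ)) :
    ∃ g : 𝓢(EuclideanSpace ℝ (Fin N), ℂ), ⇑g = fourierHat f := by
  have h : (2 * Real.pi)⁻¹ ≠ 0 := by positivity
  refine ⟨SchwartzMap.compCLMOfContinuousLinearEquiv ℂ
    (LinearEquiv.smulOfNeZero ℝ (EuclideanSpace ℝ (Fin N)) _ h).toContinuousLinearEquiv (𝓕 f), ?_⟩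
  ext ξ
  rw [fourierHat_eq, ← SchwartzMap.fourier_coe]
  rfl

lemma fourier_comp_smul {V : Type*} [NormedAddCommGroup V] [InnerProductSpace ℝ V]
    [FiniteDimensional ℝ V] [MeasurableSpace V] [BorelSpace V] (g : V → ℂ) {a : ℝ} (ha : 0 < a)
    (ξ : V) : 𝓕 (fun x => g (a • x)) ξ = (a ^ Module.finrank ℝ V)⁻¹ • 𝓕 g (a⁻¹ • ξ) := by
  rw [Real.fourier_eq, Real.fourier_eq,
    ← Measure.integral_comp_smul_of_nonneg volume _ _ (hR := ha.le)]
  congr! 4 with x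
  rw [inner_smul_left, inner_smul_right]
  simp [ha.ne']

lemma fourier_fourierHat (f : 𝓢(EuclideanSpace ℝ (Fin N), ℂ)) (x : EuclideanSpace ℝ (Fin N)) :
    𝓕 (fourierHat f) x = (2 * Real.pi) ^ N • f (-(2 * Real.pi) • x) := by
  have inversion : 𝓕 (𝓕 (f : EuclideanSpace ℝ (Fin N) → ℂ)) ((2 * Real.pi) • x) =
      f (-(2 * Real.pi) • x) := by
    have h := Real.fourierInv_eq_fourier_neg (𝓕 (f : EuclideanSpace ℝ (Fin N) → ℂ))
      (-(2 * Real.pi) • x)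
    rw [← SchwartzMap.fourier_coe, ← SchwartzMap.fourierInv_coe,
      FourierTransform.fourierInv_fourier_eq] at h
    rw [h, SchwartzMap.fourier_coe]
    simp
  rw [funext (fourierHat_eq f), fourier_comp_smul _ (by positivity), inv_inv, inversion, inv_pow,
    inv_inv, finrank_euclideanSpace_fin]

lemma rapidDecay_fourierHat_iff {Ω : EuclideanSpace ℝ (Fin N) → ℝ} (hΩ : IsModerateWeight Ω)
    (f : EuclideanSpace ℝ (Fin N) → ℂ) : RapidDecay Ω (fourierHat f) ↔ RapidDecay Ω (𝓕 f) := by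
  have two_pi_ne_zero : 2 * Real.pi ≠ 0 := by positivity
  refine ⟨fun h => ?_, fun h => ?_⟩
  · simpa only [fourierHat_eq, inv_smul_smul₀ two_pi_ne_zero] using h.comp_smul hΩ two_pi_ne_zero
  · simpa only [← fourierHat_eq] using h.comp_smul hΩ (inv_ne_zero two_pi_ne_zero)

lemma RapidDecay.fourier_fourierHat {Ω : EuclideanSpace ℝ (Fin N) → ℝ} (hΩ : IsModerateWeight Ω)
    {f : 𝓢(EuclideanSpace ℝ (Fin N), ℂ)} (hf : RapidDecay Ω f) :
    RapidDecay Ω (𝓕 (fourierHat f)) := by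
  intro r hr
  have two_pi_ne_zero : -(2 * Real.pi) ≠ 0 := neg_ne_zero.2 (by positivity)
  obtain ⟨C, hC, hfC⟩ := hf.comp_smul hΩ two_pi_ne_zero r hr
  refine ⟨(2 * Real.pi) ^ N * C, by positivity, fun x => ?_⟩
  rw [_root_.fourier_fourierHat, norm_smul, Real.norm_of_nonneg (by positivity), mul_assoc]
  gcongr
  exact hfC x

lemma norm_fourier_iteratedLineDerivOp {V : Type*} [NormedAddCommGroup V] [InnerProductSpace ℝ V]
    [FiniteDimensional ℝ V] [MeasurableSpace V] [BorelSpace V] {n : ℕ} (m : Fin n → V)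
    (f : 𝓢(V, ℂ)) (ξ : V) : ‖(𝓕 (∂^{m} f : 𝓢(V, ℂ))) ξ‖ =
      (∏ i, (2 * Real.pi * |inner ℝ ξ (m i)|)) * ‖(𝓕 f) ξ‖ := by
  induction n with
  | zero => simp
  | succ n ih =>
    rw [iteratedLineDerivOp_succ_left, SchwartzMap.fourier_lineDerivOp_eq, smul_apply,
      SchwartzMap.smulLeftCLM_apply_apply (by fun_prop), norm_smul, norm_smul, ih,
      Fin.prod_univ_succ]
    simp [abs_of_pos Real.pi_pos, Fin.tail]
    ring

lemma prod_abs_pow_mul_norm_fourierHat_le (α : Fin N → ℕ) (f : 𝓢(EuclideanSpace ℝ (Fin N), ℂ))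
    (ξ : EuclideanSpace ℝ (Fin N)) :
    (∏ j, |ξ j| ^ α j) * ‖fourierHat f ξ‖ ≤ ∫ x, ‖multiDeriv α f x‖ := by
  have symbol : ∏ i, (2 * Real.pi * |inner ℝ ((2 * Real.pi)⁻¹ • ξ) (multiDir α i)|) =
      ∏ j, |ξ j| ^ α j := by
    rw [← prod_multiDir α fun j => |ξ j|]
    refine Finset.prod_congr rfl fun i _ => ?_
    have := Real.pi_pos
    simp only [multiDir, EuclideanSpace.inner_single_right, PiLp.smul_apply, smul_eq_mul, one_mul,
      abs_mul, abs_inv, Nat.abs_ofNat, abs_of_pos Real.pi_pos, conj_trivial]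
    field_simp
  have h := norm_fourier_iteratedLineDerivOp (multiDir α) f ((2 * Real.pi)⁻¹ • ξ)
  rw [symbol, SchwartzMap.fourier_coe, SchwartzMap.fourier_coe] at h
  rw [fourierHat_eq, ← h]
  simp_rw [norm_multiDeriv]
  exact VectorFourier.norm_fourierIntegral_le_integral_norm _ _ _ _ _

end FourierHat

section PolynomialWeight

lemma isModerateWeight_log_one_add_norm {V : Type*} [NormedAddCommGroup V] [NormedSpace ℝ V] :
    IsModerateWeight fun x : V => Real.log (1 + ‖x‖) where
  continuous := Continuous.log (by fun_prop) fun x => by positivity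
  nonneg x := Real.log_nonneg (le_add_of_nonneg_right (norm_nonneg x))
  add_le := by
    refine ⟨1, le_rfl, fun x y => ?_⟩
    have h : Real.log (1 + ‖x + y‖) ≤ Real.log ((1 + ‖x‖) * (1 + ‖y‖)) := by
      gcongr
      nlinarith [norm_add_le x y, mul_nonneg (norm_nonneg x) (norm_nonneg y)]
    rw [Real.log_mul (by positivity) (by positivity)] at h
    linarith
  smul_le M := by
    have hM : 0 ≤ Real.log (1 + |M|) := Real.log_nonneg (by simp)
    refine ⟨1 + Real.log (1 + |M|), by linarith, fun x => ?_⟩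
    have hx : 0 ≤ Real.log (1 + ‖x‖) := Real.log_nonneg (by simp)
    have h : Real.log (1 + ‖M • x‖) ≤ Real.log ((1 + |M|) * (1 + ‖x‖)) := by
      gcongr
      rw [norm_smul, Real.norm_eq_abs]
      nlinarith [abs_nonneg M, norm_nonneg x]
    rw [Real.log_mul (by positivity) (by positivity)] at h
    nlinarith [mul_nonneg hM hx]
  le_linear := ⟨1, one_pos, fun x => by
    linarith [Real.log_le_sub_one_of_pos (show 0 < 1 + ‖x‖ by positivity)]⟩
  one_add_norm_le_exp := ⟨1, 1, one_pos, one_pos, fun x => by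
    rw [one_mul, one_mul, Real.exp_log (by positivity)]⟩

variable {N : ℕ}

lemma one_add_norm_pow_le (n : ℕ) (x : EuclideanSpace ℝ (Fin N)) :
    (1 + ‖x‖) ^ (n + 1) ≤ ((N : ℝ) + 1) ^ n * (1 + ∑ j, |x j| ^ (n + 1)) := by
  have h := pow_sum_le_card_mul_sum_pow (s := Finset.univ)
    (f := fun o : Option (Fin N) => o.elim 1 fun j => |x j|)
    (fun o _ => by cases o <;> simp) n
  simp only [Fintype.sum_option, Option.elim_none, Option.elim_some, one_pow, Finset.card_univ,
    Fintype.card_option, Fintype.card_fin, Nat.cast_add, Nat.cast_one] at h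
  refine le_trans ?_ h
  gcongr
  exact norm_le_sum_abs x

lemma exists_one_add_norm_pow_le_sum_monomialFun (n : ℕ) :
    ∃ (C : ℝ) (T : Finset (Fin N → ℕ)), 0 < C ∧ ∀ x : EuclideanSpace ℝ (Fin N),
      (1 + ‖x‖) ^ n ≤ C * ∑ β ∈ T, ‖(monomialFun β x : ℂ)‖ := by
  classical
  refine ⟨((N : ℝ) + 1) ^ n, insert 0 (Finset.univ.image fun j => Pi.single j (n + 1)),
    by positivity, fun x => ?_⟩
  have zero_notMem : (0 : Fin N → ℕ) ∉ Finset.univ.image fun j => Pi.single j (n + 1) := by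
    simp [Pi.single_eq_zero_iff]
  have inj : Function.Injective fun j : Fin N => (Pi.single j (n + 1) : Fin N → ℕ) := fun i j h =>
    by simpa [Pi.single_apply] using congrFun h i
  have norm_single : ∀ j, ‖(monomialFun (Pi.single j (n + 1)) x : ℂ)‖ = |x j| ^ (n + 1) := by
    intro j
    rw [norm_monomialFun]
    simp [Pi.single_apply, pow_ite]
  rw [Finset.sum_insert zero_notMem, Finset.sum_image inj.injOn, monomialFun_zero]
  simp only [norm_single, Complex.ofReal_one, norm_one]
  exact (pow_le_pow_right₀ (by simp) n.le_succ).trans (one_add_norm_pow_le n x)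

lemma exists_eLpNorm_one_le_eLpNorm_one_add_norm_pow_mul {p : ℝ≥0∞} (hp : 1 ≤ p) :
    ∃ (A : ℝ) (n : ℕ), 0 < A ∧ ∀ g : EuclideanSpace ℝ (Fin N) → ℂ, Continuous g →
      eLpNorm g 1 volume ≤
        ENNReal.ofReal A * eLpNorm (fun x => (((1 + ‖x‖) ^ n : ℝ) : ℂ) * g x) p volume := by
  obtain ⟨A, c, hA, _, hHolder⟩ :=
    (isModerateWeight_log_one_add_norm (V := EuclideanSpace ℝ (Fin N))
      ).exists_eLpNorm_one_exp_neg_mul_le volume hp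
  refine ⟨A, ⌈c⌉₊, hA, fun g hg => ?_⟩
  set G : EuclideanSpace ℝ (Fin N) → ℂ := fun x => (((1 + ‖x‖) ^ ⌈c⌉₊ : ℝ) : ℂ) * g x with hG
  have hGc : Continuous G := by fun_prop
  refine (eLpNorm_mono fun x => ?_).trans (hHolder G hGc.aestronglyMeasurable)
  have hx : 1 ≤ 1 + ‖x‖ := by simp
  have one_le : 1 ≤ Real.exp (-(c * Real.log (1 + ‖x‖))) * (1 + ‖x‖) ^ ⌈c⌉₊ := by
    rw [Real.exp_neg, mul_comm c, ← Real.rpow_def_of_pos (by positivity), ← Real.rpow_natCast,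
      inv_mul_eq_div, one_le_div (by positivity)]
    exact Real.rpow_le_rpow_of_exponent_le hx (Nat.le_ceil c)
  rw [hG, norm_mul, norm_mul, Complex.norm_real, Complex.norm_real,
    Real.norm_of_nonneg (Real.exp_pos _).le, Real.norm_of_nonneg (by positivity), ← mul_assoc]
  exact le_mul_of_one_le_left (norm_nonneg _) one_le

lemma exists_eLpNorm_one_le_sum_monomialFun {p : ℝ≥0∞} (hp : 1 ≤ p) :
    ∃ (A : ℝ) (T : Finset (Fin N → ℕ)), 0 < A ∧ ∀ g : EuclideanSpace ℝ (Fin N) → ℂ, Continuous g →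
      eLpNorm g 1 volume ≤ ENNReal.ofReal A *
        ∑ β ∈ T, eLpNorm (fun x => (monomialFun β x : ℂ) * g x) p volume := by
  obtain ⟨A, n, hA, hAg⟩ := exists_eLpNorm_one_le_eLpNorm_one_add_norm_pow_mul (N := N) hp
  obtain ⟨B, T, _, hBx⟩ := exists_one_add_norm_pow_le_sum_monomialFun (N := N) n
  refine ⟨A * B, T, by positivity, fun g hg => ?_⟩
  have norm_le : ∀ x, ‖(((1 + ‖x‖) ^ n : ℝ) : ℂ) * g x‖ ≤
      B * ‖∑ β ∈ T, ‖(monomialFun β x : ℂ) * g x‖‖ := fun x => by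
    rw [Real.norm_of_nonneg (Finset.sum_nonneg fun β _ => norm_nonneg _), norm_mul,
      Complex.norm_real, Real.norm_of_nonneg (by positivity)]
    simp only [norm_mul, ← Finset.sum_mul]
    rw [← mul_assoc]
    gcongr
    exact hBx x
  have hcont : ∀ β : Fin N → ℕ, Continuous fun x => ‖(monomialFun β x : ℂ) * g x‖ := fun β =>
    ((Complex.continuous_ofReal.comp (continuous_monomialFun β)).mul hg).norm
  calc eLpNorm g 1 volume
      ≤ ENNReal.ofReal A * eLpNorm (fun x => (((1 + ‖x‖) ^ n : ℝ) : ℂ) * g x) p volume := hAg g hg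
    _ ≤ ENNReal.ofReal A * (ENNReal.ofReal B *
        eLpNorm (∑ β ∈ T, fun x => ‖(monomialFun β x : ℂ) * g x‖) p volume) := by
        gcongr
        refine eLpNorm_le_mul_eLpNorm_of_ae_le_mul (ae_of_all _ fun x => ?_) p
        simpa only [Finset.sum_apply] using norm_le x
    _ ≤ ENNReal.ofReal A * (ENNReal.ofReal B *
        ∑ β ∈ T, eLpNorm (fun x => (monomialFun β x : ℂ) * g x) p volume) := by
        gcongr
        refine (eLpNorm_sum_le (fun β _ => (hcont β).aestronglyMeasurable) hp).trans_eq ?_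
        simp only [eLpNorm_norm]
    _ = _ := by rw [← mul_assoc, ← ENNReal.ofReal_mul hA.le]

end PolynomialWeight

section YoungFactorBounds

variable {N : ℕ} {ω σ : Fin N → ℝ → ℝ}

lemma exists_sumYoungFactor_mul_integral_norm_multiDeriv_le (f : 𝓢(EuclideanSpace ℝ (Fin N), ℂ))
    {p : ℝ≥0∞} (hp : 1 ≤ p) {r : ℝ}
    (h : ∀ β : Fin N → ℕ, ∃ C : ℝ, 0 < C ∧ ∀ α : Fin N → ℕ,
      eLpNorm (fun x => (sumYoungFactor σ r α : ℂ) * (monomialFun β x : ℂ) * multiDeriv α f x) p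
        volume ≤ ENNReal.ofReal C) :
    ∃ D : ℝ, 0 < D ∧ ∀ α, sumYoungFactor σ r α * ∫ x, ‖multiDeriv α f x‖ ≤ D := by
  obtain ⟨A, T, hA, hAT⟩ := exists_eLpNorm_one_le_sum_monomialFun (N := N) hp
  choose C hC hCα using h
  have hsum : 0 ≤ ∑ β ∈ T, C β := Finset.sum_nonneg fun β _ => (hC β).le
  refine ⟨A * (1 + ∑ β ∈ T, C β), by positivity, fun α => ?_⟩
  set g : EuclideanSpace ℝ (Fin N) → ℂ := fun x =>
    (sumYoungFactor σ r α : ℂ) * multiDeriv α f x with hg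
  have hgc : Continuous g := continuous_const.mul (continuous_multiDeriv α f)
  have hint : sumYoungFactor σ r α * ∫ x, ‖multiDeriv α f x‖ = (eLpNorm g 1 volume).toReal := by
    rw [eLpNorm_one_eq_lintegral_enorm, ← integral_norm_eq_lintegral_enorm
      hgc.aestronglyMeasurable, ← integral_const_mul]
    simp only [hg, norm_mul, Complex.norm_real, Real.norm_of_nonneg (sumYoungFactor_nonneg σ r α)]
  rw [hint]
  refine ENNReal.toReal_le_of_le_ofReal (by positivity) ?_
  calc eLpNorm g 1 volume
      ≤ ENNReal.ofReal A * ∑ β ∈ T, eLpNorm (fun x => (monomialFun β x : ℂ) * g x) p volume :=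
        hAT g hgc
    _ ≤ ENNReal.ofReal A * ∑ β ∈ T, ENNReal.ofReal (C β) := by
        gcongr with β
        simpa only [hg, mul_assoc, mul_left_comm] using hCα β α
    _ = ENNReal.ofReal (A * ∑ β ∈ T, C β) := by
        rw [ENNReal.ofReal_mul hA.le, ENNReal.ofReal_sum_of_nonneg fun β _ => (hC β).le]
    _ ≤ _ := by
        gcongr
        exact le_add_of_nonneg_left zero_le_one

lemma rapidDecay_fourierHat_of_eLpNorm_le (hσ : ∀ j, IsWeightFunction (σ j))
    (f : 𝓢(EuclideanSpace ℝ (Fin N), ℂ)) {p : ℝ≥0∞} (hp : 1 ≤ p)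
    (h : ∀ r : ℝ, 0 < r → ∀ β : Fin N → ℕ, ∃ C : ℝ, 0 < C ∧ ∀ α : Fin N → ℕ,
      eLpNorm (fun x => (sumYoungFactor σ r α : ℂ) * (monomialFun β x : ℂ) * multiDeriv α f x) p
        volume ≤ ENNReal.ofReal C) :
    RapidDecay (sumWeight σ) (fourierHat f) := by
  intro r hr
  obtain ⟨s, C, hs, hC, hexp⟩ := exists_exp_sumWeight_le_sumYoungFactor hσ hr
  obtain ⟨D, hD, hDα⟩ := exists_sumYoungFactor_mul_integral_norm_multiDeriv_le f hp (h s hs)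
  refine ⟨C * D, by positivity, fun ξ => ?_⟩
  obtain ⟨α, hα⟩ := hexp ξ
  have hY := sumYoungFactor_nonneg σ s α
  have exp_prod_le_one : ∏ j, Real.exp (-(α j : ℝ)) ≤ 1 :=
    Finset.prod_le_one (fun j _ => (Real.exp_pos _).le) fun j _ => by simp
  rw [Real.exp_neg, ← div_eq_mul_inv, le_div_iff₀' (Real.exp_pos _)]
  calc Real.exp (r * sumWeight σ ξ) * ‖fourierHat f ξ‖
      ≤ C * (1 * ((∏ j, |ξ j| ^ α j) * sumYoungFactor σ s α)) * ‖fourierHat f ξ‖ := by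
        gcongr
        exact hα.trans (by gcongr)
    _ = C * (sumYoungFactor σ s α * ((∏ j, |ξ j| ^ α j) * ‖fourierHat f ξ‖)) := by ring
    _ ≤ C * (sumYoungFactor σ s α * ∫ x, ‖multiDeriv α f x‖) := by
        gcongr
        exact prod_abs_pow_mul_norm_fourierHat_le α f ξ
    _ ≤ C * D := by
        gcongr
        exact hDα α

lemma tsum_pi_prod (g : ℕ → ℝ≥0∞) :
    ∀ n : ℕ, ∑' β : Fin n → ℕ, ∏ j, g (β j) = (∑' k, g k) ^ n
  | 0 => by simp
  | n + 1 => by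
    rw [← (Fin.consEquiv fun _ : Fin (n + 1) => ℕ).tsum_eq]
    simp only [Fin.consEquiv, Equiv.coe_fn_mk, Fin.prod_univ_succ, Fin.cons_zero, Fin.cons_succ]
    rw [ENNReal.tsum_prod (f := fun k (β : Fin n → ℕ) => g k * ∏ j, g (β j))]
    simp only [ENNReal.tsum_mul_left, tsum_pi_prod g n, ENNReal.tsum_mul_right, pow_succ']

lemma tsum_ofReal_prod_exp_neg_lt_top (n : ℕ) :
    ∑' β : Fin n → ℕ, ENNReal.ofReal (∏ j, Real.exp (-(β j : ℝ))) < ∞ := by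
  simp_rw [ENNReal.ofReal_prod_of_nonneg fun _ _ => (Real.exp_pos _).le]
  rw [tsum_pi_prod fun k => ENNReal.ofReal (Real.exp (-(k : ℝ)))]
  exact ENNReal.pow_lt_top Real.summable_exp_neg_nat.tsum_ofReal_lt_top

lemma eLpNorm_one_le_tsum_mul {X ι E F : Type*} [MeasurableSpace X] [Countable ι]
    [NormedAddCommGroup E] [NormedAddCommGroup F] {μ : Measure X} {u : X → E} {g : ι → X → F}
    {e : ι → ℝ} {D : ℝ≥0∞} (hg : ∀ i, AEStronglyMeasurable (g i) μ) (he : ∀ i, 0 ≤ e i)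
    (hu : ∀ x, ∃ i, ‖u x‖ ≤ e i * ‖g i x‖) (hD : ∀ i, eLpNorm (g i) 1 μ ≤ D) :
    eLpNorm u 1 μ ≤ (∑' i, ENNReal.ofReal (e i)) * D := by
  simp only [eLpNorm_one_eq_lintegral_enorm] at hD ⊢
  calc ∫⁻ x, ‖u x‖ₑ ∂μ ≤ ∫⁻ x, ∑' i, ENNReal.ofReal (e i) * ‖g i x‖ₑ ∂μ := by
        refine lintegral_mono fun x => ?_
        obtain ⟨i, hi⟩ := hu x
        refine le_trans ?_ (ENNReal.le_tsum i)
        rw [← ofReal_norm, ← ofReal_norm, ← ENNReal.ofReal_mul (he i)]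
        exact ENNReal.ofReal_le_ofReal hi
    _ = ∑' i, ENNReal.ofReal (e i) * ∫⁻ x, ‖g i x‖ₑ ∂μ := by
        rw [lintegral_tsum fun i => (hg i).enorm.const_mul _]
        simp only [lintegral_const_mul'' _ (hg _).enorm]
    _ ≤ ∑' i, ENNReal.ofReal (e i) * D := by
        gcongr with i
        exact hD i
    _ = _ := ENNReal.tsum_mul_right

lemma exists_exp_sumWeight_mul_norm_le (hω : ∀ j, IsWeightFunction (ω j)) {r : ℝ} (hr : 0 < r) :
    ∃ s C : ℝ, 0 < s ∧ 0 < C ∧ ∀ (x : EuclideanSpace ℝ (Fin N)) (z : ℂ), ∃ β : Fin N → ℕ,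
      Real.exp (r * sumWeight ω x) * ‖z‖ ≤ C * (∏ j, Real.exp (-(β j : ℝ))) *
        ‖(sumYoungFactor ω s β : ℂ) * (monomialFun β x : ℂ) * z‖ := by
  obtain ⟨s, C, hs, hC, hexp⟩ := exists_exp_sumWeight_le_sumYoungFactor hω hr
  refine ⟨s, C, hs, hC, fun x z => ?_⟩
  obtain ⟨β, hβ⟩ := hexp x
  refine ⟨β, (mul_le_mul_of_nonneg_right hβ (norm_nonneg z)).trans_eq ?_⟩
  rw [norm_mul, norm_mul, norm_monomialFun, Complex.norm_real,
    Real.norm_of_nonneg (sumYoungFactor_nonneg ω s β)]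
  ring

lemma rapidDecay_of_eLpNorm_le (hω : ∀ j, IsWeightFunction (ω j))
    (f : 𝓢(EuclideanSpace ℝ (Fin N), ℂ)) {q : ℝ≥0∞} (hq : 1 ≤ q)
    (h : ∀ s : ℝ, 0 < s → ∃ C : ℝ, 0 < C ∧ ∀ β : Fin N → ℕ,
      eLpNorm (fun x => (sumYoungFactor ω s β : ℂ) * (monomialFun β x : ℂ) * f x) q volume ≤
        ENNReal.ofReal C) :
    RapidDecay (sumWeight ω) f := by
  have hΩ := isModerateWeight_sumWeight hω
  have hcont := hΩ.continuous
  refine rapidDecay_of_integrable_exp_mul volume hΩ f fun r hr => ?_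
  obtain ⟨A, c, _, hc, hHolder⟩ := hΩ.exists_eLpNorm_one_exp_neg_mul_le volume hq
  obtain ⟨s, C, hs, hC, hexp⟩ := exists_exp_sumWeight_mul_norm_le hω (r := r + c) (by positivity)
  obtain ⟨D, _, hDβ⟩ := h s hs
  set g : (Fin N → ℕ) → EuclideanSpace ℝ (Fin N) → ℂ := fun β x =>
    (sumYoungFactor ω s β : ℂ) * (monomialFun β x : ℂ) * f x
  have hgc : ∀ β, Continuous (g β) := fun β =>
    (continuous_const.mul (Complex.continuous_ofReal.comp (continuous_monomialFun β))).mul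
      f.continuous
  have dominated : ∀ x, ∃ β : Fin N → ℕ, ‖Real.exp (r * sumWeight ω x) * ‖f x‖‖ ≤
      C * (∏ j, Real.exp (-(β j : ℝ))) * ‖(Real.exp (-(c * sumWeight ω x)) : ℂ) * g β x‖ := by
    intro x
    obtain ⟨β, hβ⟩ := hexp x (f x)
    refine ⟨β, ?_⟩
    rw [norm_mul _ (g β x), Complex.norm_real, Real.norm_of_nonneg (Real.exp_pos _).le,
      Real.norm_of_nonneg (by positivity)]
    calc Real.exp (r * sumWeight ω x) * ‖f x‖
        = Real.exp (-(c * sumWeight ω x)) * (Real.exp ((r + c) * sumWeight ω x) * ‖f x‖) := by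
          rw [← mul_assoc, ← Real.exp_add]
          ring_nf
      _ ≤ Real.exp (-(c * sumWeight ω x)) *
          (C * (∏ j, Real.exp (-(β j : ℝ))) * ‖g β x‖) := by gcongr
      _ = _ := by ring
  refine memLp_one_iff_integrable.1 ⟨by fun_prop, (eLpNorm_one_le_tsum_mul
    (fun β => Continuous.aestronglyMeasurable ?_) (fun β => by positivity) dominated
    fun β => (hHolder _ (hgc β).aestronglyMeasurable).trans
      (mul_le_mul_right (hDβ β) _)).trans_lt ?_⟩
  · exact Continuous.mul (by fun_prop) (hgc β)
  · simp_rw [ENNReal.ofReal_mul hC.le, ENNReal.tsum_mul_left]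
    exact ENNReal.mul_lt_top (ENNReal.mul_lt_top ENNReal.ofReal_lt_top
      (tsum_ofReal_prod_exp_neg_lt_top N)) (ENNReal.mul_lt_top ENNReal.ofReal_lt_top
        ENNReal.ofReal_lt_top)

end YoungFactorBounds

section Characterizations

open FourierTransform

variable {N : ℕ} {ω σ : Fin N → ℝ → ℝ}

lemma expE_neg_sub_eq_mul_sumYoungFactor (ω σ : Fin N → ℝ → ℝ) (r s : ℝ) (α β : Fin N → ℕ) :
    expE (-((r : EReal) * sumYoungConj σ (fun j => (α j : ℝ) / r)) -
      (s : EReal) * sumYoungConj ω (fun j => (β j : ℝ) / s)) =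
    sumYoungFactor σ r α * sumYoungFactor ω s β := by
  rw [sub_eq_add_neg, expE_add, sumYoungFactor, sumYoungFactor]

lemma exists_eLpNorm_sumYoungFactor_mul_le (hω : ∀ j, IsWeightFunction (ω j))
    (hσ : ∀ j, IsWeightFunction (σ j)) {f : 𝓢(EuclideanSpace ℝ (Fin N), ℂ)}
    (hf : RapidDecay (sumWeight ω) f) (hf' : RapidDecay (sumWeight σ) (fourierHat f)) {p : ℝ≥0∞}
    (hp : 1 ≤ p) {r s : ℝ} (hr : 0 < r) (hs : 0 < s) :
    ∃ C : ℝ, 0 < C ∧ ∀ α β : Fin N → ℕ,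
      eLpNorm (fun x => ((sumYoungFactor σ r α * sumYoungFactor ω s β : ℝ) : ℂ) *
        (monomialFun β x : ℂ) * multiDeriv α f x) p volume ≤ ENNReal.ofReal C := by
  obtain ⟨A, c, hA, hc, hLp⟩ :=
    (isModerateWeight_sumWeight hω).exists_eLpNorm_le_of_norm_le volume hp
  obtain ⟨B, hB, hmonomial⟩ := sumYoungFactor_mul_prod_le hω hs
  obtain ⟨C, hC, hderiv⟩ := exists_sumYoungFactor_mul_norm_multiDeriv_le hω hσ hf
    ((rapidDecay_fourierHat_iff (isModerateWeight_sumWeight hσ) f).1 hf') hr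
    (t := s + c) (by positivity)
  refine ⟨B * C * A, by positivity, fun α β => hLp _ (B * C) (by positivity) fun x => ?_⟩
  have hα := sumYoungFactor_nonneg σ r α
  have hβ := sumYoungFactor_nonneg ω s β
  rw [norm_mul, norm_mul, norm_monomialFun, Complex.norm_real,
    Real.norm_of_nonneg (mul_nonneg hα hβ)]
  calc sumYoungFactor σ r α * sumYoungFactor ω s β * (∏ j, |x j| ^ β j) * ‖multiDeriv α f x‖
      = (sumYoungFactor ω s β * ∏ j, |x j| ^ β j) *
          (sumYoungFactor σ r α * ‖multiDeriv α f x‖) := by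
        ring
    _ ≤ (B * Real.exp (s * sumWeight ω x)) * (C * Real.exp (-((s + c) * sumWeight ω x))) := by
        gcongr ?_ * ?_
        · exact hmonomial β x
        · exact hderiv α x
    _ = B * C * Real.exp (-(c * sumWeight ω x)) := by
        rw [mul_mul_mul_comm, ← Real.exp_add]
        ring_nf

lemma exists_eLpNorm_le_of_const_mul {X ι : Type*} [MeasurableSpace X] {μ : Measure X} {p : ℝ≥0∞}
    {F : ι → X → ℂ} {b : ℝ} (hb : 0 < b)
    (h : ∃ C : ℝ, 0 < C ∧ ∀ i, eLpNorm (fun x => (b : ℂ) * F i x) p μ ≤ ENNReal.ofReal C) :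
    ∃ C : ℝ, 0 < C ∧ ∀ i, eLpNorm (F i) p μ ≤ ENNReal.ofReal C := by
  obtain ⟨C, hC, hF⟩ := h
  refine ⟨C / b, by positivity, fun i => ?_⟩
  have hbF : ENNReal.ofReal b * eLpNorm (F i) p μ ≤ ENNReal.ofReal C := by
    have hsmul := eLpNorm_const_smul (b : ℂ) (F i) p μ
    rw [← ofReal_norm, Complex.norm_real, Real.norm_of_nonneg hb.le] at hsmul
    exact hsmul.symm.trans_le (hF i)
  rw [ENNReal.ofReal_div_of_pos hb, ENNReal.le_div_iff_mul_le (by simp [hb]) (by simp), mul_comm]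
  exact hbF

lemma exists_eLpNorm_multiDeriv_le_of_mixed (hω : ∀ j, IsWeightFunction (ω j))
    {f : EuclideanSpace ℝ (Fin N) → ℂ} {p : ℝ≥0∞} {r : ℝ}
    (h : ∀ s : ℝ, 0 < s → ∃ C : ℝ, 0 < C ∧ ∀ α β : Fin N → ℕ,
      eLpNorm (fun x => ((sumYoungFactor σ r α * sumYoungFactor ω s β : ℝ) : ℂ) *
        (monomialFun β x : ℂ) * multiDeriv α f x) p volume ≤ ENNReal.ofReal C)
    (β : Fin N → ℕ) :
    ∃ C : ℝ, 0 < C ∧ ∀ α : Fin N → ℕ,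
      eLpNorm (fun x => (sumYoungFactor σ r α : ℂ) * (monomialFun β x : ℂ) * multiDeriv α f x) p
        volume ≤ ENNReal.ofReal C := by
  obtain ⟨s, hs, hpos⟩ := exists_sumYoungFactor_pos hω β
  obtain ⟨C, hC, hle⟩ := h s hs
  refine exists_eLpNorm_le_of_const_mul hpos ⟨C, hC, fun α => ?_⟩
  simpa only [Complex.ofReal_mul, mul_comm, mul_left_comm] using hle α β

lemma exists_eLpNorm_monomialFun_mul_le_of_mixed (hσ : ∀ j, IsWeightFunction (σ j))
    {f : EuclideanSpace ℝ (Fin N) → ℂ} {p : ℝ≥0∞} {s : ℝ}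
    (h : ∀ r : ℝ, 0 < r → ∃ C : ℝ, 0 < C ∧ ∀ α β : Fin N → ℕ,
      eLpNorm (fun x => ((sumYoungFactor σ r α * sumYoungFactor ω s β : ℝ) : ℂ) *
        (monomialFun β x : ℂ) * multiDeriv α f x) p volume ≤ ENNReal.ofReal C)
    (α : Fin N → ℕ) :
    ∃ C : ℝ, 0 < C ∧ ∀ β : Fin N → ℕ,
      eLpNorm (fun x => (sumYoungFactor ω s β : ℂ) * (monomialFun β x : ℂ) * multiDeriv α f x) p
        volume ≤ ENNReal.ofReal C := by
  obtain ⟨r, hr, hpos⟩ := exists_sumYoungFactor_pos hσ α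
  obtain ⟨C, hC, hle⟩ := h r hr
  refine exists_eLpNorm_le_of_const_mul hpos ⟨C, hC, fun β => ?_⟩
  simpa only [Complex.ofReal_mul, mul_assoc] using hle α β

variable (hω : ∀ j, IsWeightFunction (ω j)) (hσ : ∀ j, IsWeightFunction (σ j))
  (f : 𝓢(EuclideanSpace ℝ (Fin N), ℂ)) {p q : ℝ≥0∞} (hp : 1 ≤ p) (hq : 1 ≤ q)

include hω hp in
lemma rapidDecay_iff_eLpNorm_monomialFun_mul_lt_top : RapidDecay (sumWeight ω) f ↔
    ∀ r : ℝ, 0 < r → ∀ α : Fin N → ℕ,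
      eLpNorm (fun x => (Real.exp (r * sumWeight ω x) : ℂ) * (monomialFun α x : ℂ) * f x)
        p volume < ∞ := by
  have hΩ := isModerateWeight_sumWeight hω
  simp only [mul_assoc]
  refine ⟨fun hf r hr α => (hf.monomialFun_mul hω α).eLpNorm_exp_mul_lt_top volume hΩ hp hr,
    fun h => (rapidDecay_iff_eLpNorm_exp_mul_lt_top volume hΩ hp f).2 fun r hr => ?_⟩
  simpa only [monomialFun_zero, Complex.ofReal_one, one_mul] using h r hr 0

include hω hσ hp in
lemma eLpNorm_exp_mul_multiDeriv_lt_top (hf : RapidDecay (sumWeight ω) f)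
    (hf' : RapidDecay (sumWeight σ) (𝓕 (f : EuclideanSpace ℝ (Fin N) → ℂ))) {r : ℝ} (hr : 0 < r)
    (α : Fin N → ℕ) :
    eLpNorm (fun x => (Real.exp (r * sumWeight ω x) : ℂ) * multiDeriv α f x) p volume < ∞ :=
  (hf.multiDeriv hω hσ hf' α).eLpNorm_exp_mul_lt_top volume (isModerateWeight_sumWeight hω) hp hr

include hω hσ hp hq

lemma rapidDecay_and_iff_eLpNorm_exp_mul_lt_top :
    RapidDecay (sumWeight ω) f ∧ RapidDecay (sumWeight σ) (fourierHat f) ↔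
      (∀ r : ℝ, 0 < r →
        eLpNorm (fun x => (Real.exp (r * sumWeight ω x) : ℂ) * f x) p volume < ∞) ∧
      (∀ r : ℝ, 0 < r →
        eLpNorm (fun ξ => (Real.exp (r * sumWeight σ ξ) : ℂ) * fourierHat f ξ) q volume < ∞) := by
  obtain ⟨g, hg⟩ := exists_schwartzMap_eq_fourierHat f
  rw [← hg]
  exact and_congr
    (rapidDecay_iff_eLpNorm_exp_mul_lt_top volume (isModerateWeight_sumWeight hω) hp f)
    (rapidDecay_iff_eLpNorm_exp_mul_lt_top volume (isModerateWeight_sumWeight hσ) hq g)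

lemma rapidDecay_and_iff_eLpNorm_monomialFun_mul_lt_top :
    RapidDecay (sumWeight ω) f ∧ RapidDecay (sumWeight σ) (fourierHat f) ↔
      (∀ r : ℝ, 0 < r → ∀ α : Fin N → ℕ,
        eLpNorm (fun x => (Real.exp (r * sumWeight ω x) : ℂ) * (monomialFun α x : ℂ) * f x)
          p volume < ∞) ∧
      (∀ r : ℝ, 0 < r → ∀ α : Fin N → ℕ,
        eLpNorm (fun ξ => (Real.exp (r * sumWeight σ ξ) : ℂ) * (monomialFun α ξ : ℂ) *
          fourierHat f ξ) q volume < ∞) := by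
  obtain ⟨g, hg⟩ := exists_schwartzMap_eq_fourierHat f
  rw [← hg]
  exact and_congr (rapidDecay_iff_eLpNorm_monomialFun_mul_lt_top hω f hp)
    (rapidDecay_iff_eLpNorm_monomialFun_mul_lt_top hσ g hq)

lemma rapidDecay_and_iff_eLpNorm_multiDeriv_lt_top :
    RapidDecay (sumWeight ω) f ∧ RapidDecay (sumWeight σ) (fourierHat f) ↔
      (∀ r : ℝ, 0 < r → ∀ α : Fin N → ℕ,
        eLpNorm (fun x => (Real.exp (r * sumWeight ω x) : ℂ) * multiDeriv α f x)
          p volume < ∞) ∧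
      (∀ r : ℝ, 0 < r → ∀ α : Fin N → ℕ,
        eLpNorm (fun ξ => (Real.exp (r * sumWeight σ ξ) : ℂ) * multiDeriv α (fourierHat f) ξ)
          q volume < ∞) := by
  refine ⟨fun ⟨hf, hf'⟩ => ⟨fun r hr α => ?_, fun r hr α => ?_⟩, fun ⟨h, h'⟩ => ?_⟩
  · exact eLpNorm_exp_mul_multiDeriv_lt_top hω hσ f hp hf
      ((rapidDecay_fourierHat_iff (isModerateWeight_sumWeight hσ) f).1 hf') hr α
  · obtain ⟨g, hg⟩ := exists_schwartzMap_eq_fourierHat f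
    have hg' := hf.fourier_fourierHat (isModerateWeight_sumWeight hω)
    rw [← hg] at hf' hg' ⊢
    exact eLpNorm_exp_mul_multiDeriv_lt_top hσ hω g hq hf' hg' hr α
  · refine (rapidDecay_and_iff_eLpNorm_exp_mul_lt_top hω hσ f hp hq).2 ⟨fun r hr => ?_,
      fun r hr => ?_⟩
    · simpa only [multiDeriv_zero] using h r hr 0
    · simpa only [multiDeriv_zero] using h' r hr 0

lemma rapidDecay_and_iff_exists_eLpNorm_le :
    RapidDecay (sumWeight ω) f ∧ RapidDecay (sumWeight σ) (fourierHat f) ↔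
      (∀ r : ℝ, 0 < r → ∀ β : Fin N → ℕ, ∃ C : ℝ, 0 < C ∧ ∀ α : Fin N → ℕ,
        eLpNorm (fun x => (sumYoungFactor σ r α : ℂ) * (monomialFun β x : ℂ) * multiDeriv α f x) p
          volume ≤ ENNReal.ofReal C) ∧
      (∀ s : ℝ, 0 < s → ∀ α : Fin N → ℕ, ∃ C : ℝ, 0 < C ∧ ∀ β : Fin N → ℕ,
        eLpNorm (fun x => (sumYoungFactor ω s β : ℂ) * (monomialFun β x : ℂ) * multiDeriv α f x) q
          volume ≤ ENNReal.ofReal C) := by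
  refine ⟨fun ⟨hf, hf'⟩ => ⟨fun r hr => ?_, fun s hs => ?_⟩, fun ⟨h, h'⟩ =>
    ⟨rapidDecay_of_eLpNorm_le hω f hq fun s hs => ?_,
      rapidDecay_fourierHat_of_eLpNorm_le hσ f hp h⟩⟩
  · exact exists_eLpNorm_multiDeriv_le_of_mixed hω fun s hs =>
      exists_eLpNorm_sumYoungFactor_mul_le hω hσ hf hf' hp hr hs
  · exact exists_eLpNorm_monomialFun_mul_le_of_mixed hσ fun r hr =>
      exists_eLpNorm_sumYoungFactor_mul_le hω hσ hf hf' hq hr hs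
  · simpa only [multiDeriv_zero] using h' s hs 0

omit hq in
lemma rapidDecay_and_iff_exists_eLpNorm_mixed_le :
    RapidDecay (sumWeight ω) f ∧ RapidDecay (sumWeight σ) (fourierHat f) ↔
      ∀ r s : ℝ, 0 < r → 0 < s → ∃ C : ℝ, 0 < C ∧ ∀ α β : Fin N → ℕ,
        eLpNorm (fun x => ((sumYoungFactor σ r α * sumYoungFactor ω s β : ℝ) : ℂ) *
          (monomialFun β x : ℂ) * multiDeriv α f x) p volume ≤ ENNReal.ofReal C := by
  refine ⟨fun ⟨hf, hf'⟩ r s hr hs => exists_eLpNorm_sumYoungFactor_mul_le hω hσ hf hf' hp hr hs,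
    fun h => (rapidDecay_and_iff_exists_eLpNorm_le hω hσ f hp hp).2 ⟨fun r hr => ?_,
      fun s hs => ?_⟩⟩
  · exact exists_eLpNorm_multiDeriv_le_of_mixed hω fun s hs => h r s hr hs
  · exact exists_eLpNorm_monomialFun_mul_le_of_mixed hσ fun r hr => h r s hr hs

omit hp hq in
lemma mem_ultraSpace_iff_rapidDecay_and : (f : EuclideanSpace ℝ (Fin N) → ℂ) ∈ ultraSpace ω σ ↔
    RapidDecay (sumWeight ω) f ∧ RapidDecay (sumWeight σ) (fourierHat f) := by
  obtain ⟨g, hg⟩ := exists_schwartzMap_eq_fourierHat f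
  rw [rapidDecay_and_iff_eLpNorm_multiDeriv_lt_top hω hσ f le_top le_top]
  exact ⟨fun ⟨_, _, _, h⟩ => h, fun h => ⟨f.integrable, f.smooth _, hg ▸ g.smooth _, h⟩⟩

end Characterizations

theorem mainTheorem6 {N : ℕ} (ω σ : Fin N → ℝ → ℝ)
    (hω : ∀ j, IsWeightFunction (ω j)) (hσ : ∀ j, IsWeightFunction (σ j))
    (f : 𝓢(EuclideanSpace ℝ (Fin N), ℂ)) (p q : ℝ≥0∞) (hp : 1 ≤ p) (hq : 1 ≤ q) :
    List.TFAE [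
      -- (1)
      (f : EuclideanSpace ℝ (Fin N) → ℂ) ∈ ultraSpace ω σ,
      -- (2)
      (∀ r : ℝ, 0 < r → ∀ α : Fin N → ℕ,
          eLpNorm (fun x => (Real.exp (r * sumWeight ω x) : ℂ) * multiDeriv α f x)
            p volume < ∞) ∧
        (∀ r : ℝ, 0 < r → ∀ α : Fin N → ℕ,
          eLpNorm (fun ξ => (Real.exp (r * sumWeight σ ξ) : ℂ) * multiDeriv α (fourierHat f) ξ)
            q volume < ∞),
      -- (3)
      (∀ r : ℝ, 0 < r →
          eLpNorm (fun x => (Real.exp (r * sumWeight ω x) : ℂ) * f x) p volume < ∞) ∧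
        (∀ r : ℝ, 0 < r →
          eLpNorm (fun ξ => (Real.exp (r * sumWeight σ ξ) : ℂ) * fourierHat f ξ)
            q volume < ∞),
      -- (4)
      (∀ r : ℝ, 0 < r → ∀ α : Fin N → ℕ,
          eLpNorm (fun x => (Real.exp (r * sumWeight ω x) : ℂ) * (monomialFun α x : ℂ) * f x)
            p volume < ∞) ∧
        (∀ r : ℝ, 0 < r → ∀ α : Fin N → ℕ,
          eLpNorm (fun ξ => (Real.exp (r * sumWeight σ ξ) : ℂ) * (monomialFun α ξ : ℂ) *
            fourierHat f ξ) q volume < ∞),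
      -- (5)
      (∀ r : ℝ, 0 < r → ∀ β : Fin N → ℕ, ∃ C : ℝ, 0 < C ∧ ∀ α : Fin N → ℕ,
          eLpNorm (fun x =>
            (expE (-((r : EReal) * sumYoungConj σ (fun j => (α j : ℝ) / r))) : ℂ) *
              (monomialFun β x : ℂ) * multiDeriv α f x) p volume ≤ ENNReal.ofReal C) ∧
        (∀ s : ℝ, 0 < s → ∀ α : Fin N → ℕ, ∃ C : ℝ, 0 < C ∧ ∀ β : Fin N → ℕ,
          eLpNorm (fun x =>
            (expE (-((s : EReal) * sumYoungConj ω (fun j => (β j : ℝ) / s))) : ℂ) *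
              (monomialFun β x : ℂ) * multiDeriv α f x) q volume ≤ ENNReal.ofReal C),
      -- (6)
      ∀ r s : ℝ, 0 < r → 0 < s → ∃ C : ℝ, 0 < C ∧ ∀ α β : Fin N → ℕ,
        eLpNorm (fun x =>
          (expE (-((r : EReal) * sumYoungConj σ (fun j => (α j : ℝ) / r)) -
              (s : EReal) * sumYoungConj ω (fun j => (β j : ℝ) / s)) : ℂ) *
            (monomialFun β x : ℂ) * multiDeriv α f x) p volume ≤ ENNReal.ofReal C
    ] := by
  simp only [expE_neg_sub_eq_mul_sumYoungFactor]
  refine List.tfae_of_forall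
    (RapidDecay (sumWeight ω) f ∧ RapidDecay (sumWeight σ) (fourierHat f)) _ ?_
  simp only [List.forall_mem_cons, List.not_mem_nil, IsEmpty.forall_iff, implies_true, and_true]
  exact ⟨mem_ultraSpace_iff_rapidDecay_and hω hσ f,
    (rapidDecay_and_iff_eLpNorm_multiDeriv_lt_top hω hσ f hp hq).symm,
    (rapidDecay_and_iff_eLpNorm_exp_mul_lt_top hω hσ f hp hq).symm,
    (rapidDecay_and_iff_eLpNorm_monomialFun_mul_lt_top hω hσ f hp hq).symm,
    (rapidDecay_and_iff_exists_eLpNorm_le hω hσ f hp hq).symm,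
    (rapidDecay_and_iff_exists_eLpNorm_mixed_le hω hσ f hp).symm⟩
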